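/- Let $S$ be an integrally closed Noetherian domain with fraction field $L$, and let $p$ be a prime number whose image in $S$ is a non-zero prime element. Call $f\in S$ *square-free* if $fS_Q=QS_Q$ for every height-one prime $Q$ of $S$ containing $f$. Let $F$ be the fraction field of $S/pS$. Let $f_1,\dots,f_r,g_1,\dots,g_t\in S$ be square-free elements such that no two members of the list $f_1,\dots,f_r,g_1,\dots,g_t$ are contained in the same height-one prime of $S$. Assume: (a) $f_1,\dots,f_r$ define a class one radical tower: each $f_i$ is a non-unit and there are $h_i\in S$ with $f_i\equiv h_i^p \bmod p^2S$; (b) $g_1,\dots,g_t$ are linearly disjoint modulo $p$: writing $\bar g_j$ for the image of $g_j$ in $F$, no $\bar g_j$ is a $p$-th power in $F$, and there is an isomorphism of $F$-vector spaces $$F(\sqrt[p]{\bar g_1})\otimes_F\cdots\otimes_F F(\sqrt[p]{\bar g_t})\;\cong\; F(\sqrt[p]{\bar g_1},\dots,\sqrt[p]{\bar g_t}).$$ Let $\omega_1,\dots,\omega_r,\kappa_1,\dots,\kappa_t$ be elements of some field extension of $L$ with $\omega_i^p=f_i$ and $\kappa_j^p=g_j$, and set $K:=L(\omega_1,\dots,\omega_r,\kappa_1,\dots,\kappa_t)$.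 Then the integral closure of $S$ in $K$ is a free $S$-module. In particular, if $S$ is Cohen-Macaulay, or if $S$ is an unramified regular local ring of mixed characteristic $p$ (a regular local ring $(S,\mathfrak m)$ of characteristic zero with residue field of characteristic $p$ and $p\notin\mathfrak m^2$), then the integral closure of $S$ in $K$ is a Cohen-Macaulay ring. -/

import Mathlib

/-- `f` is square-free: `f S_Q = Q S_Q` for every height one prime `Q` of `S` containing `f`. -/
def IsSquareFreeElem {S : Type*} [CommRing S] (f : S) : Prop :=
  ∀ (Q : Ideal S) [Q.IsPrime], Q.height = 1 → f ∈ Q →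
    Ideal.span {algebraMap S (Localization.AtPrime Q) f} =
      Q.map (algebraMap S (Localization.AtPrime Q))

/-- The condition `𝒜₁`: no two members of the family lie in the same height one prime of `S`. -/
def SatisfiesA1 {S ι : Type*} [CommRing S] (f : ι → S) : Prop :=
  ∀ i j : ι, i ≠ j → ∀ Q : Ideal S, Q.IsPrime → Q.height = 1 → ¬ (f i ∈ Q ∧ f j ∈ Q)

/-- The set `S^{p ∧ p²}` of the elements of `S` that are `p`-th powers modulo `p² S`. -/
def pthPowersModSq (S : Type*) [CommRing S] (p : ℕ) : Set S :=
  {f | ∃ h : S, f - h ^ p ∈ Ideal.span {(p : S) ^ 2}}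

/-- The elements `f i` define a class one radical tower: they are square-free non-units (hence
non-zero as soon as `S` has a height one prime), satisfy `𝒜₁`, and are `p`-th powers modulo
`p² S`. -/
structure IsClassOneTower {S ι : Type*} [CommRing S] (p : ℕ) (f : ι → S) : Prop where
  squareFree : ∀ i, IsSquareFreeElem (f i)
  not_isUnit : ∀ i, ¬ IsUnit (f i)
  satisfiesA1 : SatisfiesA1 f
  mem_pthPowersModSq : ∀ i, f i ∈ pthPowersModSq S p

/-- The elements `g j` of `S` are linearly disjoint modulo `p`, where `F` is the fraction field of
`S / p S`: no residue `ḡ j` is a `p`-th power in `F`, and the tensor product over `F` of the fields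
`F(ḡ j ^ (1/p))` is isomorphic, as an `F`-vector space, to `F(ḡ j ^ (1/p) : j)`.
The field `F` has characteristic `p`, so the `p`-th roots `β j` in its algebraic closure exist and
are unique. -/
def LinearlyDisjointModP {S ι : Type*} [CommRing S] (p : ℕ) (F : Type*) [Field F]
    [Algebra (S ⧸ Ideal.span {(p : S)}) F] (g : ι → S) : Prop :=
  (∀ j, ¬ ∃ a : F, a ^ p =
      algebraMap (S ⧸ Ideal.span {(p : S)}) F (Ideal.Quotient.mk _ (g j))) ∧
  ∃ β : ι → AlgebraicClosure F,
    (∀ j, β j ^ p = algebraMap F (AlgebraicClosure F)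
      (algebraMap (S ⧸ Ideal.span {(p : S)}) F (Ideal.Quotient.mk _ (g j)))) ∧
    Nonempty (PiTensorProduct F (fun j => IntermediateField.adjoin F {β j}) ≃ₗ[F]
      IntermediateField.adjoin F (Set.range β))

/-- A Cohen-Macaulay local ring: a Noetherian local ring whose maximal ideal contains a regular
sequence of length the Krull dimension (equivalently, depth equals dimension). -/
structure IsCohenMacaulayLocalRing (R : Type*) [CommRing R] : Prop where
  isLocalRing : IsLocalRing R
  isNoetherianRing : IsNoetherianRing R
  exists_isRegular : ∃ rs : List R, (∀ x ∈ rs, x ∈ IsLocalRing.maximalIdeal R) ∧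
    RingTheory.Sequence.IsRegular R rs ∧ (rs.length : WithBot ℕ∞) = ringKrullDim R

/-- A Cohen-Macaulay ring: a Noetherian ring whose localizations at all maximal ideals are
Cohen-Macaulay local rings. -/
structure IsCohenMacaulayRing (R : Type*) [CommRing R] : Prop where
  isNoetherianRing : IsNoetherianRing R
  localization : ∀ (m : Ideal R) [m.IsMaximal],
    IsCohenMacaulayLocalRing (Localization.AtPrime m)

/-- An unramified regular local ring of mixed characteristic `p`: a regular local ring `(S, m)`
of characteristic zero with residue field of characteristic `p` such that `p ∉ m²`. -/
structure IsUnramifiedRegularLocalRing (p : ℕ) (S : Type*) [CommRing S] : Prop where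
  isRegularLocalRing : IsRegularLocalRing S
  charZero : CharZero S
  charP_residueField : CharP (IsLocalRing.ResidueField S) p
  natCast_notMem : (p : S) ∉ IsLocalRing.maximalIdeal S ^ 2

/-! The integral closure has an explicit basis. Choose `h i` with `f i ≡ h i ^ p` modulo `p ^ 2`;
the basis consists of the monomials `∏ (ω i - h i) ^ a i * ∏ κ j ^ b j`, with all exponents below
`p`, divided by `p ^ (⌊∑ a i / (p - 1)⌋)` (`scaledMonomial`).

They are integral because, after adjoining a primitive `p`-th root of unity `ζ` and putting `λ = ζ -
1`, so that `λ ^ (p - 1) = p * u` with `u` a unit, the congruence modulo `p ^ 2` gives `ω i - h i =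
λ * w i` with `w i` integral (`exists_sub_one_mul_eq_sub`). The denominator cancels, leaving `λ ^ (∑
a i mod (p - 1))` times an integral element.

They span in two stages. Away from `p`: by Kummer theory the Galois group multiplies the roots
independently by powers of `ζ`, so averaging isolates each coefficient of an integral element up to
a power of `p`. Since the radicands are square-free and share no height one prime, normality makes
that coefficient integral (`isIntegral_coeff_of_sum`). Hence `p ^ N * z` lies in the span for every
integral `z`.

At `p`: the span is `p`-saturated among integral elements (`mem_span_scaledMonomial_of_smul_mem`).
Conjugating `p * z` by `ω i ↦ ζ ^ j i * ω i` replaces `w i` by `w i + ω i * (1 + ⋯ + ζ ^ (j i -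
1))`, which is `w i + j i * ω i` modulo a prime over `p`. Comparing powers of `λ` one layer at a
time, a polynomial of degree below `p` in each variable vanishes on a grid of side `p`, so it is
zero; linear disjointness modulo `p` then makes every coefficient divisible by `p`.

A finite free algebra over a Cohen-Macaulay ring is Cohen-Macaulay, and regular local rings are
Cohen-Macaulay, which gives the last claim. -/

section CohenMacaulay

/-! ### Regular local rings and Cohen-Macaulay rings -/

open IsLocalRing RingTheory.Sequence
open scoped Pointwise

/-- Prime avoidance for `m ^ 2` and the finitely many minimal primes: Nakayama excludes `m = m ^ 2`,
and positive dimension excludes `m` being minimal. -/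
theorem IsRegularLocalRing.exists_notMem_sq_of_succ {R : Type*} [CommRing R]
    [IsRegularLocalRing R] {d : ℕ} (hd : (maximalIdeal R).spanFinrank = d + 1) :
    ∃ x ∈ maximalIdeal R, x ∉ maximalIdeal R ^ 2 ∧ ∀ P ∈ minimalPrimes R, x ∉ P := by
  classical
  have hfg := (maximalIdeal R).fg_of_isNoetherianRing
  have hdim : ringKrullDim R = (d + 1 : ℕ) := by
    rw [← hd]; exact (IsRegularLocalRing.spanFinrank_maximalIdeal (R := R)).symm
  by_contra! hcon
  have hfin : (insert (maximalIdeal R ^ 2) (minimalPrimes R)).Finite :=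
    (minimalPrimes.finite_of_isNoetherianRing R).insert _
  have hsub : (maximalIdeal R : Set R) ⊆
      ⋃ i ∈ insert (maximalIdeal R ^ 2) (minimalPrimes R), ((id i : Ideal R) : Set R) := by
    intro x hx
    by_cases hx2 : x ∈ maximalIdeal R ^ 2
    · exact Set.mem_biUnion (Set.mem_insert _ _) hx2
    · obtain ⟨P, hP, hxP⟩ := hcon x hx hx2
      exact Set.mem_biUnion (Set.mem_insert_of_mem _ hP) hxP
  -- Prime avoidance tolerates two ideals that are not prime; both slots are filled by `m ^ 2`.
  obtain ⟨I, hI, hle⟩ := (Ideal.subset_union_prime_finite hfin (f := id)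
    (maximalIdeal R ^ 2) (maximalIdeal R ^ 2) (by
      intro i hi h1 _
      rcases hi with rfl | hi
      · exact absurd rfl h1
      · exact hi.1.1)).1 hsub
  rcases hI with rfl | hI
  · have h0 : maximalIdeal R = ⊥ := by
      refine Submodule.eq_bot_of_le_smul_of_le_jacobson_bot (maximalIdeal R) _ hfg ?_
        (maximalIdeal_le_jacobson _)
      simpa [pow_two] using hle
    have := (Submodule.spanFinrank_eq_zero_iff_eq_bot hfg).2 h0
    omega
  · have hP := hI.1.1
    have heq : maximalIdeal R = I := le_antisymm hle (le_maximalIdeal hP.ne_top)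
    have h0 : (maximalIdeal R).height = 0 := by
      rw [Ideal.height_eq_zero_iff, heq]; exact hI
    have := maximalIdeal_height_eq_ringKrullDim (R := R)
    rw [h0, hdim] at this
    norm_cast at this

/-- Since `x ∉ m ^ 2`, some coefficient of `x` on a minimal generating set is a unit, so modulo `x`
that generator is redundant. -/
theorem IsLocalRing.spanFinrank_maximalIdeal_quotient_le {R : Type*} [CommRing R]
    [IsLocalRing R] [IsNoetherianRing R] {d : ℕ} (hd : (maximalIdeal R).spanFinrank = d + 1)
    {x : R} (hx : x ∈ maximalIdeal R) (hx2 : x ∉ maximalIdeal R ^ 2)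
    [IsLocalRing (R ⧸ Ideal.span {x})] :
    (maximalIdeal (R ⧸ Ideal.span {x})).spanFinrank ≤ d := by
  classical
  have hfg := (maximalIdeal R).fg_of_isNoetherianRing
  have hgfin := Submodule.FG.finite_generators hfg
  set G := hgfin.toFinset with hG
  have hGspan : Ideal.span (G : Set R) = maximalIdeal R := by
    rw [hG, Set.Finite.coe_toFinset]; exact Submodule.span_generators _
  have hGcard : G.card = d + 1 := by
    rw [← hd, ← Submodule.FG.generators_ncard hfg, Set.ncard_eq_toFinset_card _ hgfin]
  have hxm := hx
  rw [← hGspan] at hxm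
  obtain ⟨c, -, hc⟩ := Submodule.mem_span_finset.1 hxm
  have hmem : ∀ a ∈ G, a ∈ maximalIdeal R := fun a ha => by
    rw [← hGspan]; exact Ideal.subset_span ha
  obtain ⟨y, hy, hcy⟩ : ∃ y ∈ G, c y ∉ maximalIdeal R := by
    by_contra! h
    refine hx2 ?_
    rw [← hc, pow_two]
    exact Ideal.sum_mem _ fun a ha => Ideal.mul_mem_mul (h a ha) (hmem a ha)
  obtain ⟨u, hu⟩ := (notMem_maximalIdeal.1 hcy)
  have hmap : maximalIdeal (R ⧸ Ideal.span {x}) =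
      Submodule.span _ ((Ideal.Quotient.mk (Ideal.span {x})) '' (G.erase y : Set R)) := by
    rw [← map_maximalIdeal_of_surjective (Ideal.Quotient.mk (Ideal.span {x}))
      Ideal.Quotient.mk_surjective]
    refine le_antisymm ?_ ?_
    · rw [← hGspan, Ideal.map_span, Ideal.span_le]
      rintro _ ⟨a, ha, rfl⟩
      by_cases hay : a = y
      · subst hay
        have h1 : Ideal.Quotient.mk (Ideal.span {x}) (∑ b ∈ G, c b • b) = 0 := by
          rw [hc]; exact Ideal.Quotient.eq_zero_iff_mem.2 (Ideal.mem_span_singleton_self x)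
        rw [← Finset.add_sum_erase _ _ hy, map_add, smul_eq_mul, ← hu, map_mul] at h1
        have h2 : Ideal.Quotient.mk (Ideal.span {x}) a =
            -(Ideal.Quotient.mk (Ideal.span {x}) ((u⁻¹ : Rˣ) : R)) *
              Ideal.Quotient.mk (Ideal.span {x}) (∑ b ∈ G.erase a, c b • b) := by
          have h3 := eq_neg_of_add_eq_zero_left h1
          calc Ideal.Quotient.mk (Ideal.span {x}) a
              = Ideal.Quotient.mk (Ideal.span {x}) ((u⁻¹ : Rˣ) : R) *
                (Ideal.Quotient.mk (Ideal.span {x}) (u : R) *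
                  Ideal.Quotient.mk (Ideal.span {x}) a) := by
                rw [← mul_assoc, ← map_mul, Units.inv_mul, map_one, one_mul]
            _ = _ := by rw [h3]; ring
        rw [h2]
        refine Ideal.mul_mem_left _ _ ?_
        rw [map_sum]
        refine Submodule.sum_mem _ fun b hb => ?_
        rw [smul_eq_mul, map_mul]
        exact Ideal.mul_mem_left _ _ (Submodule.subset_span ⟨b, hb, rfl⟩)
      · exact Submodule.subset_span ⟨a, Finset.mem_coe.2 (Finset.mem_erase.2 ⟨hay, ha⟩), rfl⟩
    · refine Submodule.span_le.2 ?_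
      rintro _ ⟨a, ha, rfl⟩
      exact Ideal.mem_map_of_mem _ (hmem a (Finset.mem_of_mem_erase ha))
  rw [hmap]
  refine (Submodule.spanFinrank_span_le_ncard_of_finite ((Finset.finite_toSet _).image _)).trans ?_
  refine (Set.ncard_image_le (Finset.finite_toSet _)).trans ?_
  rw [Set.ncard_coe_finset, Finset.card_erase_of_mem hy, hGcard]
  simp

/-- A regular local ring is a domain whose maximal ideal contains a regular sequence of length
the embedding dimension. -/
theorem IsRegularLocalRing.isDomain_and_exists_isWeaklyRegular (d : ℕ) :
    ∀ (R : Type*) [CommRing R] [IsRegularLocalRing R], (maximalIdeal R).spanFinrank = d →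
      IsDomain R ∧ ∃ rs : List R, (∀ x ∈ rs, x ∈ maximalIdeal R) ∧
        IsWeaklyRegular R rs ∧ rs.length = d := by
  induction d with
  | zero =>
    intro R _ _ hd
    have h0 := (Submodule.spanFinrank_eq_zero_iff_eq_bot
      (maximalIdeal R).fg_of_isNoetherianRing).1 hd
    exact ⟨(isField_iff_maximalIdeal_eq.2 h0).isDomain, [], by simp, IsWeaklyRegular.nil _ _, rfl⟩
  | succ d ih =>
    intro R _ _ hd
    obtain ⟨x, hx, hx2, hxP⟩ := exists_notMem_sq_of_succ hd
    have hdim : ringKrullDim R = (d + 1 : ℕ) := by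
      rw [← hd]; exact (IsRegularLocalRing.spanFinrank_maximalIdeal (R := R)).symm
    have hne : Ideal.span {x} ≠ ⊤ := fun h =>
      (Ideal.IsPrime.ne_top (inferInstance : (maximalIdeal R).IsPrime))
        (top_le_iff.1 (h ▸ (Ideal.span_singleton_le_iff_mem _).2 hx))
    have : Nontrivial (R ⧸ Ideal.span {x}) := Ideal.Quotient.nontrivial_iff.2 hne
    have : IsLocalRing (R ⧸ Ideal.span {x}) :=
      IsLocalRing.of_surjective' (Ideal.Quotient.mk _) Ideal.Quotient.mk_surjective
    have hle := IsLocalRing.spanFinrank_maximalIdeal_quotient_le hd hx hx2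
    have hxt : x • (⊤ : Ideal R) = Ideal.span {x} := by
      ext z
      simp [Submodule.mem_smul_pointwise_iff_exists, Ideal.mem_span_singleton', mul_comm]
    -- Killing one element of `m` lowers the dimension by at most one, so the quotient is again
    -- regular.
    have hdim' : (d : WithBot ℕ∞) ≤ ringKrullDim (R ⧸ Ideal.span {x}) := by
      have h := ringKrullDim_le_ringKrullDim_quotSMulTop_succ hx
      rw [hxt, hdim] at h
      push_cast at h
      exact (ENat.WithBot.add_le_add_one_right_iff).1 h
    have hreg : IsRegularLocalRing (R ⧸ Ideal.span {x}) :=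
      IsRegularLocalRing.of_spanFinrank_maximalIdeal_le _ (le_trans (by exact_mod_cast hle) hdim')
    have hrank : (maximalIdeal (R ⧸ Ideal.span {x})).spanFinrank = d := by
      refine le_antisymm hle ?_
      rw [← IsRegularLocalRing.spanFinrank_maximalIdeal] at hdim'
      exact_mod_cast hdim'
    obtain ⟨hdom, rs, hrs, hwr, hlen⟩ := ih (R ⧸ Ideal.span {x}) hrank
    have hprime : (Ideal.span {x}).IsPrime := (Ideal.Quotient.isDomain_iff_prime _).1 hdom
    obtain ⟨P, hP, hPx⟩ := Ideal.exists_minimalPrimes_le (bot_le (a := Ideal.span {x}))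
    have hPp : P.IsPrime := hP.1.1
    -- The minimal prime `P` lies in `(x)` but does not contain `x`, so `P = x P ⊆ m P` and Nakayama
    -- applies.
    have hPbot : P = ⊥ := by
      refine Submodule.eq_bot_of_le_smul_of_le_jacobson_bot (maximalIdeal R) P
        P.fg_of_isNoetherianRing ?_ (maximalIdeal_le_jacobson _)
      intro y hy
      obtain ⟨z, rfl⟩ := Ideal.mem_span_singleton'.1 (hPx hy)
      rw [mul_comm]
      exact Submodule.smul_mem_smul hx ((hPp.mem_or_mem hy).resolve_right (hxP P hP))
    subst hPbot
    have hdomR : IsDomain R := IsDomain.of_bot_isPrime R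
    refine ⟨hdomR, ?_⟩
    obtain ⟨rs', rfl⟩ : ∃ rs' : List R, rs'.map (algebraMap R (R ⧸ Ideal.span {x})) = rs :=
      List.map_surjective_iff.2 Ideal.Quotient.mk_surjective rs
    refine ⟨x :: rs', ?_, ?_, by simpa using hlen⟩
    · intro y hy
      rcases List.mem_cons.1 hy with rfl | hy
      · exact hx
      · have h := hrs _ (List.mem_map_of_mem hy)
        have hloc : IsLocalHom (algebraMap R (R ⧸ Ideal.span {x})) :=
          IsLocalHom.of_surjective _ Ideal.Quotient.mk_surjective
        rw [mem_maximalIdeal, mem_nonunits_iff] at h ⊢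
        exact fun hu => h (hu.map _)
    · have hx0 : x ≠ 0 := fun h => hxP ⊥ hP (by simp [h])
      refine IsWeaklyRegular.cons (isSMulRegular_iff_right_eq_zero_of_smul.2 ?_) ?_
      · intro y hy
        exact (mul_eq_zero.1 hy).resolve_left hx0
      · rw [isWeaklyRegular_map_algebraMap_iff] at hwr
        exact (LinearEquiv.isWeaklyRegular_congr (Submodule.quotEquivOfEq _ _ hxt) rs').2 hwr

theorem IsRegularLocalRing.isCohenMacaulayLocalRing (R : Type*) [CommRing R]
    [IsRegularLocalRing R] : IsCohenMacaulayLocalRing R := by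
  obtain ⟨-, rs, hrs, hwr, hlen⟩ := isDomain_and_exists_isWeaklyRegular _ R rfl
  exact ⟨inferInstance, inferInstance, rs, hrs,
    IsRegular.of_isWeaklyRegular_of_mem_maximalIdeal R hrs hwr, by
      rw [hlen]; exact IsRegularLocalRing.spanFinrank_maximalIdeal⟩

theorem IsRegularLocalRing.isCohenMacaulayRing (R : Type*) [CommRing R]
    [IsRegularLocalRing R] : IsCohenMacaulayRing R := by
  refine ⟨inferInstance, fun m hm => ?_⟩
  obtain rfl := eq_maximalIdeal hm
  have e : R ≃ₐ[R] Localization.AtPrime (maximalIdeal R) :=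
    IsLocalization.atUnits R (maximalIdeal R).primeCompl fun x hx =>
      notMem_maximalIdeal.1 hx
  have := IsRegularLocalRing.of_ringEquiv e.toRingEquiv
  exact IsRegularLocalRing.isCohenMacaulayLocalRing _

/-- Incomparability: contraction along an integral extension is strictly monotone on primes, so
chains below `P` contract to chains of the same length. -/
theorem Ideal.height_le_height_under_of_isIntegral {A B : Type*} [CommRing A] [CommRing B]
    [Algebra A B] [Algebra.IsIntegral A B] (P : Ideal B) [P.IsPrime] :
    P.height ≤ (P.under A).height := by
  have h1 := PrimeSpectrum.height_eq_orderHeight ⟨P, inferInstance⟩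
  have h2 := PrimeSpectrum.height_eq_orderHeight ⟨P.under A, inferInstance⟩
  refine h1.trans_le (le_trans ?_ h2.ge)
  refine Order.height_le_height_apply_of_strictMono (PrimeSpectrum.comap (algebraMap A B)) ?_
    (⟨P, inferInstance⟩ : PrimeSpectrum B)
  intro I J hIJ
  exact Ideal.IsIntegral.comap_lt_comap hIJ

/-- Regular sequences survive flat local maps, and integrality keeps the dimension of the
localization from exceeding that of the base. -/
theorem IsCohenMacaulayRing.of_free {A B : Type*} [CommRing A] [CommRing B] [Algebra A B]
    [Module.Free A B] [Module.Finite A B] (h : IsCohenMacaulayRing A) :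
    IsCohenMacaulayRing B := by
  have := h.isNoetherianRing
  have hB : IsNoetherianRing B := IsNoetherianRing.of_finite A B
  refine ⟨hB, fun n hn => ?_⟩
  have hm : (n.under A).IsMaximal := Ideal.IsMaximal.under A n
  obtain ⟨_, _, rs, hrs, hreg, hlen⟩ := h.localization (n.under A)
  let := Localization.AtPrime.algebraOfLiesOver (n.under A) n
  have hloc : IsLocalHom
      (algebraMap (Localization.AtPrime (n.under A)) (Localization.AtPrime n)) := by
    rw [RingHom.algebraMap_toAlgebra]
    exact Localization.isLocalHom_localRingHom (n.under A) n (algebraMap A B) Ideal.LiesOver.over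
  have hwr := hreg.toIsWeaklyRegular.of_flat (S := Localization.AtPrime n)
  have hmem : ∀ x ∈ rs.map (algebraMap _ (Localization.AtPrime n)),
      x ∈ maximalIdeal (Localization.AtPrime n) := by
    intro x hx
    obtain ⟨y, hy, rfl⟩ := List.mem_map.1 hx
    exact map_nonunit _ _ (hrs y hy)
  have hreg' := IsRegular.of_isWeaklyRegular_of_mem_maximalIdeal _ hmem hwr
  refine ⟨inferInstance, inferInstance, _, hmem, hreg', le_antisymm ?_ ?_⟩
  · rw [← ringKrullDim_add_length_eq_ringKrullDim_of_isRegular _ hreg']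
    refine le_add_of_nonneg_left ?_
    have := hreg'.quot_ofList_smul_nontrivial ⊤
    rw [smul_eq_mul, Ideal.mul_top] at this
    exact ringKrullDim_nonneg_of_nontrivial
  · rw [List.length_map, hlen, IsLocalization.AtPrime.ringKrullDim_eq_height n,
      IsLocalization.AtPrime.ringKrullDim_eq_height (n.under A)]
    exact WithBot.coe_le_coe.2 (Ideal.height_le_height_under_of_isIntegral n)

end CohenMacaulay

/-! ### Height one primes, square-free elements and normality -/

theorem Ideal.height_eq_one_of_mem_minimalPrimes_span_singleton {S : Type*} [CommRing S]
    [IsDomain S] [IsNoetherianRing S] {x : S} (hx : x ≠ 0) {Q : Ideal S} [Q.IsPrime]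
    (hQ : Q ∈ (Ideal.span {x}).minimalPrimes) : Q.height = 1 := by
  refine le_antisymm (Ideal.height_le_one_of_isPrincipal_of_mem_minimalPrimes _ _ hQ) ?_
  refine Order.one_le_iff_ne_zero.2 fun h => hx ?_
  rw [Ideal.height_eq_zero_iff_eq_bot] at h
  have := hQ.1.2 (Ideal.mem_span_singleton_self x)
  rwa [h, Ideal.mem_bot] at this

theorem exists_height_eq_one_of_not_isUnit {S : Type*} [CommRing S] [IsDomain S]
    [IsNoetherianRing S] {x : S} (hx : x ≠ 0) (hu : ¬ IsUnit x) :
    ∃ Q : Ideal S, Q.IsPrime ∧ Q.height = 1 ∧ x ∈ Q := by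
  obtain ⟨Q, hQ⟩ := (Ideal.span {x}).nonempty_minimalPrimes (by simpa)
  have := hQ.1.1
  exact ⟨Q, this, Ideal.height_eq_one_of_mem_minimalPrimes_span_singleton hx hQ,
    hQ.1.2 (Ideal.mem_span_singleton_self x)⟩

/-- The form in which square-freeness is used: `f` generates `Q S_Q`, with denominators cleared. -/
theorem IsSquareFreeElem.exists_mul_eq {S : Type*} [CommRing S] [IsDomain S] {f : S}
    (hf : IsSquareFreeElem f) {Q : Ideal S} [Q.IsPrime] (hQ : Q.height = 1) (hfQ : f ∈ Q)
    {t : S} (ht : t ∈ Q) : ∃ s ∉ Q, ∃ a, s * t = a * f := by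
  have h := Ideal.mem_map_of_mem (algebraMap S (Localization.AtPrime Q)) ht
  rw [← hf Q hQ hfQ] at h
  obtain ⟨y, hy⟩ := Ideal.mem_span_singleton'.1 h
  obtain ⟨⟨a, s⟩, rfl⟩ := IsLocalization.mk'_surjective Q.primeCompl y
  refine ⟨s, s.2, a, ?_⟩
  apply IsLocalization.injective (Localization.AtPrime Q) Q.primeCompl_le_nonZeroDivisors
  rw [map_mul, map_mul, ← hy, ← mul_assoc, mul_comm _ (IsLocalization.mk' _ a s),
    IsLocalization.mk'_spec]

/-- `Q` is an associated prime of the cyclic submodule of `L / S` generated by the class of `c`. -/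
theorem exists_prime_conductor {S L : Type*} [CommRing S] [IsNoetherianRing S]
    [Field L] [Algebra S L] {c : L} (hc : c ∉ Set.range (algebraMap S L)) :
    ∃ (s : S) (Q : Ideal S), Q.IsPrime ∧
      ∀ t : S, t ∈ Q ↔ t • (s • c) ∈ Set.range (algebraMap S L) := by
  let N : Submodule S L := LinearMap.range (Algebra.linearMap S L)
  have hx : N.mkQ c ≠ 0 := by
    simpa [N] using hc
  let M : Submodule S (L ⧸ N) := Submodule.span S {N.mkQ c}
  have : Nontrivial M := ⟨⟨⟨N.mkQ c, Submodule.mem_span_singleton_self _⟩, 0, fun h =>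
    hx (congrArg Subtype.val h)⟩⟩
  obtain ⟨Q, hQ⟩ := associatedPrimes.nonempty S M
  obtain ⟨hQp, ⟨y, hyM⟩, hy⟩ := isAssociatedPrime_iff.1 hQ
  obtain ⟨s, rfl⟩ := Submodule.mem_span_singleton.1 hyM
  refine ⟨s, Q, hQp, fun t => ?_⟩
  rw [hy, Submodule.mem_colon_singleton, Submodule.mem_bot, Subtype.ext_iff]
  change t • s • N.mkQ c = 0 ↔ _
  rw [← map_smul, ← map_smul, Submodule.mkQ_apply, Submodule.Quotient.mk_eq_zero]
  rfl

section IntegrallyClosed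

variable {S : Type*} [CommRing S] [IsDomain S] [IsNoetherianRing S] [IsIntegrallyClosed S]
  {L : Type*} [Field L] [Algebra S L] [IsFractionRing S L]

/-- A prime conductor of an element of the fraction field of a Noetherian integrally closed domain
has height one. -/
theorem IsIntegrallyClosed.height_eq_one_of_conductor {c : L} {Q : Ideal S} [hQp : Q.IsPrime]
    (hQ : ∀ t : S, t ∈ Q ↔ t • c ∈ Set.range (algebraMap S L)) : Q.height = 1 := by
  obtain ⟨⟨b, q⟩, hbq⟩ := IsLocalization.surj (nonZeroDivisors S) c
  have hq0 : (q : S) ≠ 0 := nonZeroDivisors.ne_zero q.2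
  have hqQ : (q : S) ∈ Q := (hQ _).2 ⟨b, by rw [Algebra.smul_def, mul_comm]; exact hbq.symm⟩
  have hc : c ∉ Set.range (algebraMap S L) := fun h =>
    hQp.ne_top ((Ideal.eq_top_iff_one Q).2 ((hQ 1).2 (by simpa using h)))
  -- If `Q c ⊆ Q`, then `c` is integral by the determinant trick, hence in `S`. So some `t ∈ Q` has
  -- `t c = u ∉ Q`, and `t` generates `Q` locally; Krull's theorem then bounds the height.
  obtain ⟨t, ht, u, hu, huQ⟩ : ∃ t ∈ Q, ∃ u, algebraMap S L u = t • c ∧ u ∉ Q := by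
    by_contra! hcon
    refine hc ((IsIntegrallyClosed.isIntegral_iff (R := S)).1 ?_)
    refine isIntegral_of_smul_mem_submodule (M := L)
      (N := Submodule.map (Algebra.linearMap S L) Q) ?_ ?_ c ?_
    · intro h
      have : algebraMap S L q ∈ Submodule.map (Algebra.linearMap S L) Q := ⟨q, hqQ, rfl⟩
      rw [h, Submodule.mem_bot, map_eq_zero_iff _ (IsFractionRing.injective S L)] at this
      exact hq0 this
    · exact Submodule.FG.map (Algebra.linearMap S L) (IsNoetherian.noetherian Q)
    · rintro _ ⟨t, ht, rfl⟩
      obtain ⟨u, hu⟩ := (hQ t).1 ht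
      refine ⟨u, hcon t ht u hu, ?_⟩
      rw [Algebra.linearMap_apply, hu, Algebra.linearMap_apply, Algebra.smul_def, smul_eq_mul,
        mul_comm]
  have ht0 : t ≠ 0 := by
    rintro rfl
    rw [zero_smul, map_eq_zero_iff _ (IsFractionRing.injective S L)] at hu
    exact huQ (hu ▸ Q.zero_mem)
  refine Ideal.height_eq_one_of_mem_minimalPrimes_span_singleton ht0
    ⟨⟨hQp, (Ideal.span_singleton_le_iff_mem _).2 ht⟩, ?_⟩
  rintro Q' ⟨hQ'p, hQ't⟩ hle y hy
  obtain ⟨v, hv⟩ := (hQ y).1 hy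
  have h : y * u = v * t := by
    apply IsFractionRing.injective S L
    rw [map_mul, map_mul, hu, hv, Algebra.smul_def, Algebra.smul_def]
    ring
  have h1 : y * u ∈ Q' := h ▸ Q'.mul_mem_left v (hQ't (Ideal.mem_span_singleton_self t))
  exact (hQ'p.mem_or_mem h1).resolve_right fun h => huQ (hle h)

variable {ι : Type*} [Fintype ι] {W : ι → S}

/-- For pairwise coprime square-free elements `W i`, an element `c` of the fraction field with
`c ^ p * ∏ W i ^ m i` integral and all `m i < p` is integral. -/
theorem mem_range_of_pow_mul_prod_mem_range (hW : ∀ i, IsSquareFreeElem (W i))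
    (hA : SatisfiesA1 W) {p : ℕ} (hp : 0 < p) {m : ι → ℕ} (hm : ∀ i, m i < p) {c : L}
    (hc : c ^ p * algebraMap S L (∏ i, W i ^ m i) ∈ Set.range (algebraMap S L)) :
    c ∈ Set.range (algebraMap S L) := by
  classical
  by_contra hcon
  obtain ⟨s, Q, hQp, hQ⟩ := exists_prime_conductor hcon
  have hQ1 := IsIntegrallyClosed.height_eq_one_of_conductor hQ
  set d := s • c with hd
  obtain ⟨s0, hs0⟩ : ∃ s0, algebraMap S L s0 = d ^ p * algebraMap S L (∏ i, W i ^ m i) := by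
    obtain ⟨s0, hs0⟩ := hc
    refine ⟨s ^ p * s0, ?_⟩
    rw [map_mul, hs0, hd, Algebra.smul_def, map_pow]; ring
  have key : ∀ (x : L) (y : S), x ^ p = algebraMap S L y → ∃ q, algebraMap S L q = x := by
    intro x y hxy
    refine IsIntegrallyClosed.isIntegral_iff.1 (IsIntegral.of_pow hp ?_)
    rw [hxy]; exact isIntegral_algebraMap
  by_cases hi : ∃ i, W i ∈ Q
  · obtain ⟨i, hi⟩ := hi
    set u := ∏ k ∈ Finset.univ.erase i, W k ^ m k with hu
    have huQ : u ∉ Q := by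
      intro h
      obtain ⟨k, hk, hkQ⟩ := hQp.prod_mem_iff.1 h
      exact hA i k (Finset.ne_of_mem_erase hk).symm Q hQp hQ1 ⟨hi, hQp.mem_of_pow_mem _ hkQ⟩
    have hprod : ∏ k, W k ^ m k = W i ^ m i * u :=
      (Finset.mul_prod_erase _ _ (Finset.mem_univ i)).symm
    -- The multiplier `W i * u` leaves `W i` with exponent `p - m i > 0`. The integral element
    -- obtained therefore lies in `Q`, and cancelling `W i` in `S_Q` puts `d` there, against the
    -- choice of `Q`.
    have hpow : (d * algebraMap S L (W i * u)) ^ p =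
        algebraMap S L (s0 * W i ^ (p - m i) * u ^ (p - 1)) := by
      obtain ⟨k, hk⟩ := Nat.exists_eq_add_of_lt (hm i)
      obtain ⟨l, rfl⟩ : ∃ l, p = l + 1 := ⟨p - 1, by omega⟩
      rw [hprod] at hs0
      have : (algebraMap S L) (W i * u) ^ (l + 1) =
          algebraMap S L (W i ^ m i * u) * algebraMap S L (W i ^ (k + 1)) *
            algebraMap S L (u ^ l) := by
        rw [← map_pow, ← map_mul, ← map_mul, mul_pow, pow_succ u,
          show l + 1 = m i + (k + 1) by omega, pow_add]
        congr 1; ring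
      rw [show l + 1 - m i = k + 1 by omega, Nat.add_sub_cancel, mul_pow, this,
        map_mul _ _ (u ^ l), map_mul _ s0, hs0]
      ring
    obtain ⟨q, hq⟩ := key _ _ hpow
    have hqQ : q ∈ Q := by
      refine hQp.mem_of_pow_mem p ?_
      have : q ^ p = s0 * W i ^ (p - m i) * u ^ (p - 1) :=
        IsFractionRing.injective S L (by rw [map_pow, hq, hpow])
      rw [this]
      refine Q.mul_mem_right _ (Q.mul_mem_left _ (Q.pow_mem_of_mem hi _ ?_))
      have := hm i; omega
    obtain ⟨s', hs', a, ha⟩ := (hW i).exists_mul_eq hQ1 hi hqQ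
    have hWi : algebraMap S L (W i) ≠ 0 := by
      intro h
      rw [map_eq_zero_iff _ (IsFractionRing.injective S L)] at h
      obtain ⟨t, ht, ht0⟩ := (Submodule.ne_bot_iff Q).1 (Ideal.ne_bot_of_height_eq_one hQ1)
      obtain ⟨s'', hs'', a, ha⟩ := (hW i).exists_mul_eq hQ1 hi ht
      rw [h, mul_zero, mul_eq_zero] at ha
      exact ha.elim (fun h => hs'' (h ▸ Q.zero_mem)) ht0
    have hsu : s' * u ∈ Q := by
      refine (hQ _).2 ⟨a, mul_right_cancel₀ hWi ?_⟩
      rw [← map_mul, ← ha, map_mul, hq, Algebra.smul_def, map_mul, map_mul]; ring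
    exact (hQp.mem_or_mem hsu).elim hs' huQ
  · push Not at hi
    set u := ∏ k, W k ^ m k with hu
    have huQ : u ∉ Q := by
      intro h
      obtain ⟨k, hk, hkQ⟩ := hQp.prod_mem_iff.1 h
      exact hi k (hQp.mem_of_pow_mem _ hkQ)
    have hpow : (d * algebraMap S L u) ^ p = algebraMap S L (s0 * u ^ (p - 1)) := by
      obtain ⟨l, rfl⟩ : ∃ l, p = l + 1 := ⟨p - 1, by omega⟩
      rw [map_mul, hs0, mul_pow, Nat.add_sub_cancel, map_pow]; ring
    obtain ⟨q, hq⟩ := key _ _ hpow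
    exact huQ ((hQ u).2 ⟨q, by rw [hq, Algebra.smul_def, mul_comm]⟩)

end IntegrallyClosed

/-- In valuation terms: `W i` is a uniformizer at `Q` and the other factors are units there, so `p`
divides `e i < p`. -/
theorem exponent_eq_zero_of_prod_eq_pow {S ι : Type*} [CommRing S] [IsDomain S] [Fintype ι]
    {W : ι → S} (hA : SatisfiesA1 W) {p : ℕ} {e : ι → ℕ} {c : S}
    (hc : ∏ i, W i ^ e i = c ^ p) {i : ι} (hWi : IsSquareFreeElem (W i)) (hi : e i < p)
    {Q : Ideal S} [hQp : Q.IsPrime] (hQ1 : Q.height = 1) (hiQ : W i ∈ Q) : e i = 0 := by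
  classical
  by_contra h0
  set u := ∏ k ∈ Finset.univ.erase i, W k ^ e k with hu
  have huQ : u ∉ Q := by
    intro h
    obtain ⟨k, hk, hkQ⟩ := hQp.prod_mem_iff.1 h
    exact hA i k (Finset.ne_of_mem_erase hk).symm Q hQp hQ1 ⟨hiQ, hQp.mem_of_pow_mem _ hkQ⟩
  have hprod : W i ^ e i * u = c ^ p := by
    rw [← hc]; exact Finset.mul_prod_erase _ (fun k => W k ^ e k) (Finset.mem_univ i)
  have hcQ : c ∈ Q := by
    refine hQp.mem_of_pow_mem p ?_
    rw [← hprod]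
    exact Q.mul_mem_right _ (Q.pow_mem_of_mem hiQ _ (by omega))
  obtain ⟨s, hs, a, ha⟩ := hWi.exists_mul_eq hQ1 hiQ hcQ
  have hWi0 : W i ≠ 0 := by
    intro h
    obtain ⟨t, ht, ht0⟩ := (Submodule.ne_bot_iff Q).1 (Ideal.ne_bot_of_height_eq_one hQ1)
    obtain ⟨s'', hs'', a, ha⟩ := hWi.exists_mul_eq hQ1 hiQ ht
    rw [h, mul_zero, mul_eq_zero] at ha
    exact ha.elim (fun h => hs'' (h ▸ Q.zero_mem)) ht0
  have h1 : s ^ p * u = a ^ p * W i ^ (p - e i) := by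
    apply mul_left_cancel₀ (pow_ne_zero (e i) hWi0)
    have h2 : W i ^ p = W i ^ e i * W i ^ (p - e i) := by rw [← pow_add]; congr 1; omega
    calc W i ^ e i * (s ^ p * u) = s ^ p * (W i ^ e i * u) := by ring
      _ = (a * W i) ^ p := by rw [hprod, ← mul_pow, ha]
      _ = _ := by rw [mul_pow, h2]; ring
  have h3 : s ^ p * u ∈ Q := by
    rw [h1]; exact Q.mul_mem_left _ (Q.pow_mem_of_mem hiQ _ (by omega))
  exact (hQp.mem_or_mem h3).elim (fun h => hs (hQp.mem_of_pow_mem _ h)) huQ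

theorem height_span_singleton_eq_one_of_prime {S : Type*} [CommRing S] [IsDomain S]
    [IsNoetherianRing S] {x : S} (hx : Prime x) : (Ideal.span {x}).height = 1 :=
  Ideal.height_span_singleton_eq_one_of_mem_nonZeroDivisors
    (mem_nonZeroDivisors_of_ne_zero hx.ne_zero) hx.not_isUnit

/-- If `p ∣ f` then `p ∣ h`, so `p ^ 2` divides `h ^ p` and hence `f`, contradicting square-freeness
at the height one prime `(p)`. -/
theorem IsSquareFreeElem.not_dvd_of_mem_pthPowersModSq {S : Type*} [CommRing S] [IsDomain S]
    [IsNoetherianRing S] {p : ℕ} (hp : p.Prime) (hpS : Prime (p : S)) {f : S}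
    (hf : IsSquareFreeElem f) (hfp : f ∈ pthPowersModSq S p) : ¬ (p : S) ∣ f := by
  intro hdvd
  have hP : (Ideal.span {(p : S)}).IsPrime := (Ideal.span_singleton_prime hpS.ne_zero).2 hpS
  obtain ⟨h, hh⟩ := hfp
  rw [Ideal.mem_span_singleton] at hh
  have hph : (p : S) ∣ h := by
    refine hpS.dvd_of_dvd_pow (n := p) ?_
    have := (Dvd.dvd.trans (dvd_pow_self _ two_ne_zero) hh)
    exact (dvd_sub_right hdvd).1 this
  have hf2 : (p : S) ^ 2 ∣ f := by
    have : (p : S) ^ 2 ∣ h ^ p := (pow_dvd_pow _ hp.two_le).trans (pow_dvd_pow_of_dvd hph p)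
    exact (dvd_sub_left this).1 hh
  obtain ⟨b, rfl⟩ := hf2
  obtain ⟨s, hs, a, ha⟩ := hf.exists_mul_eq (height_span_singleton_eq_one_of_prime hpS)
    (Ideal.mem_span_singleton.2 hdvd) (Ideal.mem_span_singleton_self _)
  refine hs (Ideal.mem_span_singleton.2 ⟨a * b, mul_right_cancel₀ hpS.ne_zero ?_⟩)
  rw [ha]; ring

/-! ### Roots of unity, Kummer theory and projection to eigenspaces -/

theorem IsPrimitiveRoot.pow_zmod_val_add {R : Type*} [CommMonoid R] {p : ℕ} [NeZero p] {ζ : R}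
    (hζ : IsPrimitiveRoot ζ p) (a b : ZMod p) :
    ζ ^ (a + b).val = ζ ^ a.val * ζ ^ b.val := by
  rw [ZMod.val_add, ← pow_add, ← pow_mod_orderOf ζ (a.val + b.val), ← hζ.eq_orderOf]

/-- Kummer theory: if no non-trivial monomial in the `p`-th roots `W i` lies in the base field,
then the Galois group multiplies them independently by `p`-th roots of unity. -/
theorem exists_algEquiv_apply_eq_pow_mul {M Ω : Type*} [Field M] [Field Ω] [Algebra M Ω]
    [IsGalois M Ω] {p : ℕ} (hp : p.Prime) {ζ : M} (hζ : IsPrimitiveRoot ζ p) {ι : Type*}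
    [Fintype ι] {W : ι → Ω} (hW0 : ∀ i, W i ≠ 0) (hW : ∀ i, ∃ a : M, W i ^ p = algebraMap M Ω a)
    (hind : ∀ e : ι → ℕ, (∀ i, e i < p) → ∏ i, W i ^ e i ∈ Set.range (algebraMap M Ω) →
      ∀ i, e i = 0) (j : ι → ℕ) :
    ∃ σ : Ω ≃ₐ[M] Ω, ∀ i, σ (W i) = algebraMap M Ω ζ ^ j i * W i := by
  classical
  have : Fact p.Prime := ⟨hp⟩
  have hζΩ : IsPrimitiveRoot (algebraMap M Ω ζ) p := hζ.map_of_injective (algebraMap M Ω).injective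
  set z := algebraMap M Ω ζ with hz
  let H : AddSubgroup (ι → ZMod p) :=
    { carrier := {k | ∃ σ : Ω ≃ₐ[M] Ω, ∀ i, σ (W i) = z ^ (k i).val * W i}
      zero_mem' := ⟨1, fun i => by simp⟩
      add_mem' := by
        rintro k l ⟨σ, hσ⟩ ⟨τ, hτ⟩
        refine ⟨σ * τ, fun i => ?_⟩
        rw [AlgEquiv.mul_apply, hτ, map_mul, map_pow, hz, AlgEquiv.commutes, ← hz, hσ, Pi.add_apply,
          hζΩ.pow_zmod_val_add]
        ring
      neg_mem' := by
        rintro k ⟨σ, hσ⟩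
        refine ⟨σ⁻¹, fun i => ?_⟩
        apply σ.injective
        have h1 : σ (σ⁻¹ (W i)) = W i := AlgEquiv.apply_symm_apply σ _
        rw [h1, map_mul, map_pow, hz, AlgEquiv.commutes, ← hz, hσ, ← mul_assoc, Pi.neg_apply,
          ← hζΩ.pow_zmod_val_add]
        simp }
  let V : Submodule (ZMod p) (ι → ZMod p) := AddSubgroup.toZModSubmodule p H
  -- A proper subspace of exponent vectors is killed by a nonzero functional. Its coefficients are
  -- the exponents of a Galois-invariant monomial, which `hind` forces to be trivial.
  have hV : V = ⊤ := by
    by_contra hne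
    obtain ⟨u, hu0, hu⟩ := Submodule.exists_le_ker_of_lt_top V (lt_top_iff_ne_top.2 hne)
    refine hu0 ?_
    have happ : ∀ k : ι → ZMod p, u k = ∑ i, k i * u (Pi.single i 1) := by
      intro k
      conv_lhs => rw [pi_eq_sum_univ' k]
      rw [map_sum]
      refine Finset.sum_congr rfl fun i _ => ?_
      rw [map_smul, smul_eq_mul]
    set e : ι → ℕ := fun i => (u (Pi.single i 1)).val with he
    have hfix : ∏ i, W i ^ e i ∈ Set.range (algebraMap M Ω) := by
      rw [InfiniteGalois.mem_range_algebraMap_iff_fixed]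
      intro σ
      have hex : ∀ i, ∃ k : ZMod p, σ (W i) = z ^ k.val * W i := by
        intro i
        obtain ⟨a, ha⟩ := hW i
        have h1 : (σ (W i) / W i) ^ p = 1 := by
          rw [div_pow, ← map_pow, ha, AlgEquiv.commutes, ← ha, div_self (pow_ne_zero _ (hW0 i))]
        obtain ⟨k, hk, hk'⟩ := hζΩ.eq_pow_of_pow_eq_one h1
        refine ⟨k, ?_⟩
        rw [ZMod.val_natCast_of_lt hk, hk', div_mul_cancel₀ _ (hW0 i)]
      choose k hk using hex
      have hkV : k ∈ V := ⟨σ, hk⟩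
      have huk : u k = 0 := hu hkV
      rw [map_prod]
      have h2 : ∏ i, σ (W i ^ e i) = z ^ (∑ i, (k i).val * e i) * ∏ i, W i ^ e i := by
        rw [← Finset.prod_pow_eq_pow_sum, ← Finset.prod_mul_distrib]
        refine Finset.prod_congr rfl fun i _ => ?_
        rw [map_pow, hk, mul_pow, pow_mul]
      rw [h2, hζΩ.pow_eq_one_iff_dvd _ |>.2, one_mul]
      rw [← ZMod.natCast_eq_zero_iff]
      push_cast
      simp only [he, ZMod.natCast_val, ZMod.cast_id', id_eq]
      rw [← happ, huk]
    have h0 := hind e (fun i => ZMod.val_lt _) hfix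
    ext k
    simp only [LinearMap.coe_comp, LinearMap.coe_single, Function.comp_apply, LinearMap.zero_apply]
    exact (ZMod.val_eq_zero _).1 (h0 k)
  have hmem : (fun i => (j i : ZMod p)) ∈ V := hV ▸ Submodule.mem_top
  obtain ⟨σ, hσ⟩ := hmem
  refine ⟨σ, fun i => ?_⟩
  rw [hσ, ZMod.val_natCast]
  congr 1
  conv_rhs => rw [← pow_mod_orderOf, ← hζΩ.eq_orderOf]

/-- Otherwise `X ^ p - v` is irreducible and `c` has degree `p`, while `L(ζ)` has degree at most `p
- 1`. -/
theorem exists_pow_eq_of_pow_eq_adjoin_primitiveRoot {L Ω : Type*} [Field L] [Field Ω]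
    [Algebra L Ω] {p : ℕ} (hp : p.Prime) {ζ : Ω} (hζ : IsPrimitiveRoot ζ p) {v : L} {c : Ω}
    (hc : c ∈ IntermediateField.adjoin L {ζ}) (hcv : c ^ p = algebraMap L Ω v) :
    ∃ b : L, b ^ p = v := by
  by_contra! hcon
  have hirr := X_pow_sub_C_irreducible_of_prime hp hcon
  have hmin : minpoly L c = Polynomial.X ^ p - Polynomial.C v :=
    (minpoly.eq_of_irreducible_of_monic hirr (by simp [hcv])
      (Polynomial.monic_X_pow_sub_C v hp.ne_zero)).symm
  have hζint : IsIntegral L ζ := hζ.isIntegral hp.pos |>.tower_top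
  have hfin : FiniteDimensional L (IntermediateField.adjoin L {ζ}) :=
    IntermediateField.adjoin.finiteDimensional hζint
  have h1 : (minpoly L (⟨c, hc⟩ : IntermediateField.adjoin L {ζ})).natDegree ≤
      Module.finrank L (IntermediateField.adjoin L {ζ}) := minpoly.natDegree_le _
  have h2 : minpoly L (⟨c, hc⟩ : IntermediateField.adjoin L {ζ}) = minpoly L c :=
    (minpoly.algebraMap_eq (B := IntermediateField.adjoin L {ζ}) (B' := Ω)
      (algebraMap (IntermediateField.adjoin L {ζ}) Ω).injective ⟨c, hc⟩).symm
  rw [h2, hmin, Polynomial.natDegree_X_pow_sub_C, IntermediateField.adjoin.finrank hζint] at h1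
  have h3 : (minpoly L ζ).natDegree ≤ (Polynomial.cyclotomic p L).natDegree := by
    refine Polynomial.natDegree_le_of_dvd (minpoly.dvd L ζ ?_) (Polynomial.cyclotomic_ne_zero p L)
    have := hζ.isRoot_cyclotomic hp.pos
    rwa [Polynomial.IsRoot, ← Polynomial.map_cyclotomic p (algebraMap L Ω),
      Polynomial.eval_map_algebraMap] at this
  rw [Polynomial.natDegree_cyclotomic, Nat.totient_prime hp] at h3
  have := hp.pos
  omega

theorem IsPrimitiveRoot.sum_fin_pow_mul {R : Type*} [CommRing R] [IsDomain R] {p : ℕ} {ζ : R}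
    (hζ : IsPrimitiveRoot ζ p) (k : ℕ) :
    ∑ l : Fin p, (ζ ^ (l : ℕ)) ^ k = if p ∣ k then (p : R) else 0 := by
  have h : ∀ l : Fin p, (ζ ^ (l : ℕ)) ^ k = (ζ ^ k) ^ (l : ℕ) := fun l => by
    rw [← pow_mul, ← pow_mul, mul_comm]
  simp_rw [h]
  rw [Fin.sum_univ_eq_sum_range (fun l => (ζ ^ k) ^ l) p]
  split_ifs with hk
  · rw [(hζ.pow_eq_one_iff_dvd k).2 hk]; simp
  · have h1 : ζ ^ k ≠ 1 := fun h => hk ((hζ.pow_eq_one_iff_dvd k).1 h)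
    have h2 := geom_sum_mul (ζ ^ k) p
    rw [← pow_mul, mul_comm k p, pow_mul, hζ.pow_eq_one, one_pow, sub_self] at h2
    exact (mul_eq_zero.1 h2).resolve_right (sub_ne_zero.2 h1)

/-- Projection onto the eigenspace of a monomial. -/
theorem sum_pow_mul_algHom_apply {L Ω : Type*} [Field L] [Field Ω] [Algebra L Ω] {p : ℕ}
    {ζ : Ω} (hζ : IsPrimitiveRoot ζ p) {ι : Type*} [Fintype ι] [DecidableEq ι] {W : ι → Ω}
    {σ : (ι → Fin p) → Ω →ₐ[L] Ω} (hσ : ∀ j i, σ j (W i) = ζ ^ (j i : ℕ) * W i)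
    (c : (ι → Fin p) → L) (m : ι → Fin p) :
    ∑ j, (∏ i, (ζ ^ (j i : ℕ)) ^ (p - m i : ℕ)) * σ j (∑ k, c k • ∏ i, W i ^ (k i : ℕ)) =
      (p : Ω) ^ Fintype.card ι * (c m • ∏ i, W i ^ (m i : ℕ)) := by
  have h1 : ∀ j, (∏ i, (ζ ^ (j i : ℕ)) ^ (p - m i : ℕ)) *
      σ j (∑ k, c k • ∏ i, W i ^ (k i : ℕ)) =
      ∑ k, (∏ i, (ζ ^ (j i : ℕ)) ^ (p - m i + k i : ℕ)) * (c k • ∏ i, W i ^ (k i : ℕ)) := by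
    intro j
    rw [map_sum, Finset.mul_sum]
    refine Finset.sum_congr rfl fun k _ => ?_
    simp_rw [map_smul, map_prod, map_pow, hσ, mul_pow, Finset.prod_mul_distrib, pow_add,
      Finset.prod_mul_distrib, Algebra.smul_def]
    ring
  simp_rw [h1]
  rw [Finset.sum_comm]
  simp_rw [← Finset.sum_mul]
  have h2 : ∀ k : ι → Fin p, ∑ j : ι → Fin p, ∏ i, (ζ ^ (j i : ℕ)) ^ (p - m i + k i : ℕ) =
      if k = m then (p : Ω) ^ Fintype.card ι else 0 := by
    intro k
    rw [← Fintype.prod_sum (fun i (l : Fin p) => (ζ ^ (l : ℕ)) ^ (p - m i + k i : ℕ))]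
    simp_rw [hζ.sum_fin_pow_mul]
    -- The exponent `p - m i` stands for `-m i`. The sum lies between `1` and `2p - 1`, so only the
    -- multiple `p` can occur.
    have h3 : ∀ i, p ∣ p - m i + k i ↔ k i = m i := by
      intro i
      have := (m i).2
      have := (k i).2
      constructor
      · rintro ⟨q, hq⟩
        rw [Fin.ext_iff]
        have hq1 : q = 1 := by
          have : q < 2 := by
            by_contra! hq2
            have := Nat.mul_le_mul_left p hq2
            omega
          interval_cases q <;> omega
        rw [hq1] at hq
        omega
      · intro h
        rw [h]
        exact ⟨1, by omega⟩
    simp_rw [h3]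
    split_ifs with hkm
    · subst hkm; simp
    · obtain ⟨i, hi⟩ := Function.ne_iff.1 hkm
      exact Finset.prod_eq_zero (Finset.mem_univ i) (if_neg hi)
  simp_rw [h2]
  simp

/-! ### Monomials with exponents below `p`, grids, and the element `ζ - 1` -/

/-- If each `y i ^ p` is a combination of lower powers, the box monomials span the algebra. -/
theorem Algebra.adjoin_range_le_span_box {R A ι : Type*} [CommRing R] [CommRing A] [Algebra R A]
    [Fintype ι] {p : ℕ} (hp : 0 < p) {y : ι → A}
    (hy : ∀ i, y i ^ p ∈ Submodule.span R (Set.range fun k : Fin p => y i ^ (k : ℕ))) :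
    Subalgebra.toSubmodule (Algebra.adjoin R (Set.range y)) ≤
      Submodule.span R (Set.range fun m : ι → Fin p => ∏ i, y i ^ (m i : ℕ)) := by
  classical
  set M := Submodule.span R (Set.range fun m : ι → Fin p => ∏ i, y i ^ (m i : ℕ)) with hM
  have hone : (1 : A) ∈ M :=
    Submodule.subset_span ⟨fun _ => ⟨0, hp⟩, by simp⟩
  have hgen : ∀ i, ∀ x ∈ M, y i * x ∈ M := by
    intro i x hx
    induction hx using Submodule.span_induction with
    | zero => simp
    | add a b _ _ ha hb => rw [mul_add]; exact M.add_mem ha hb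
    | smul r a _ ha => rw [mul_smul_comm]; exact M.smul_mem r ha
    | mem x hx =>
      obtain ⟨m, rfl⟩ := hx
      set q := ∏ k ∈ Finset.univ.erase i, y k ^ (m k : ℕ) with hq
      have hpow : ∀ k : Fin p, q * y i ^ (k : ℕ) ∈ M := by
        intro k
        refine Submodule.subset_span ⟨Function.update m i k, ?_⟩
        change ∏ l, y l ^ (Function.update m i k l : ℕ) = _
        rw [← Finset.mul_prod_erase _ _ (Finset.mem_univ i), Function.update_self, mul_comm, hq]
        congr 1
        refine Finset.prod_congr rfl fun l hl => ?_
        rw [Function.update_of_ne (Finset.ne_of_mem_erase hl)]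
      have hprod : y i * ∏ k, y k ^ (m k : ℕ) = q * y i ^ ((m i : ℕ) + 1) := by
        rw [← Finset.mul_prod_erase _ _ (Finset.mem_univ i), hq]; ring
      change y i * ∏ k, y k ^ (m k : ℕ) ∈ M
      rw [hprod]
      by_cases hlt : (m i : ℕ) + 1 < p
      · exact hpow ⟨_, hlt⟩
      · have : (m i : ℕ) + 1 = p := by have := (m i).2; omega
        rw [this]
        have hle : Submodule.span R (Set.range fun k : Fin p => y i ^ (k : ℕ)) ≤
            M.comap (LinearMap.mulLeft R q) := by
          rw [Submodule.span_le]
          rintro _ ⟨k, rfl⟩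
          exact hpow k
        exact hle (hy i)
  intro a ha
  have key : ∀ x ∈ M, a * x ∈ M := by
    rw [Subalgebra.mem_toSubmodule] at ha
    induction ha using Algebra.adjoin_induction with
    | mem x hx => obtain ⟨i, rfl⟩ := hx; exact hgen i
    | algebraMap r => intro x hx; rw [← Algebra.smul_def]; exact M.smul_mem r hx
    | add a b _ _ ha hb => intro x hx; rw [add_mul]; exact M.add_mem (ha x hx) (hb x hx)
    | mul a b _ _ ha hb => intro x hx; rw [mul_assoc]; exact ha _ (hb x hx)
  simpa using key 1 hone

/-- The `c a` are the coefficients of a polynomial of degree below `p` in each variable; such a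
polynomial vanishing on a grid with `p` points per side is zero. -/
theorem eq_zero_of_forall_grid_sum_eq_zero {D ι : Type*} [CommRing D] [IsDomain D] [Fintype ι]
    [DecidableEq ι]
    {p : ℕ} {x : ι → Fin p → D} (hx : ∀ i, Function.Injective (x i)) {c : (ι → Fin p) → D}
    (h : ∀ j : ι → Fin p, ∑ a, c a * ∏ i, x i (j i) ^ (a i : ℕ) = 0) (a : ι → Fin p) :
    c a = 0 := by
  classical
  let e : (ι → Fin p) → ι →₀ ℕ := fun a => Finsupp.equivFunOnFinite.symm fun i => (a i : ℕ)
  have he : Function.Injective e := fun a b hab => by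
    ext i; exact DFunLike.congr_fun hab i
  let P : MvPolynomial ι D := ∑ a, MvPolynomial.monomial (e a) (c a)
  have hcoeff : P.coeff (e a) = c a := by
    simp only [P, MvPolynomial.coeff_sum, MvPolynomial.coeff_monomial]
    rw [Finset.sum_eq_single a] <;> simp +contextual [he.eq_iff]
  have hP : P = 0 := by
    refine MvPolynomial.eq_zero_of_eval_zero_at_prod_finset P (fun i => Finset.univ.image (x i))
      ?_ ?_
    · intro i
      rw [Finset.card_image_of_injective _ (hx i), Finset.card_univ, Fintype.card_fin]
      have hpos : 0 < p := (a i).pos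
      refine lt_of_le_of_lt (MvPolynomial.degreeOf_sum_le _ _ _) ?_
      rw [Finset.sup_lt_iff (by simpa using hpos)]
      intro b _
      by_cases hb : c b = 0
      · simpa [hb] using hpos
      · rw [MvPolynomial.degreeOf_monomial_eq _ _ hb]
        exact (b i).2
    · intro y hy
      have : ∀ i, ∃ k, x i k = y i := fun i => by simpa using hy i
      choose j hj using this
      rw [← h j]
      simp only [P, map_sum, MvPolynomial.eval_monomial]
      refine Finset.sum_congr rfl fun b _ => ?_
      congr 1
      rw [Finsupp.prod_fintype _ _ (by simp)]
      refine Finset.prod_congr rfl fun i _ => ?_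
      rw [hj]; rfl
  rw [← hcoeff, hP, MvPolynomial.coeff_zero]

/-- `p` is the product of the `1 - ζ ^ k` for `0 < k < p`, each an associate of `ζ - 1`. -/
theorem IsPrimitiveRoot.exists_isUnit_sub_one_pow_eq {T : Type*} [CommRing T] [IsDomain T]
    {p : ℕ} (hp : p.Prime) {ζ : T} (hζ : IsPrimitiveRoot ζ p) :
    ∃ u : T, IsUnit u ∧ (ζ - 1) ^ (p - 1) = p * u := by
  obtain ⟨n, rfl⟩ : ∃ n, p = n + 1 := ⟨p - 1, by have := hp.pos; omega⟩
  have hprod := hζ.prod_one_sub_pow_eq_order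
  have hassoc : Associated ((ζ - 1) ^ n) (∏ k ∈ Finset.range n, (1 - ζ ^ (k + 1))) := by
    have : (ζ - 1) ^ n = ∏ k ∈ Finset.range n, (ζ - 1) := by simp
    rw [this]
    refine Associated.prod _ _ _ fun k hk => ?_
    have hk' := Finset.mem_range.1 hk
    have h1 : (k + 1).Coprime (n + 1) :=
      (Nat.coprime_of_lt_prime (by omega) (by omega) hp).symm
    have h2 := hζ.associated_sub_one_pow_sub_one_of_coprime h1
    rw [← neg_sub (ζ ^ (k + 1)) 1]
    exact h2.trans (Associated.neg_right (Associated.refl _))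
  rw [hprod] at hassoc
  obtain ⟨u, hu⟩ := hassoc.symm
  exact ⟨u, u.isUnit, by push_cast; exact hu.symm⟩

/-! ### Divisibility by `p` from conjugate sums -/

section

variable {S T ι₁ ι₂ : Type*} [CommRing S] [CommRing T] [IsDomain T] [Algebra S T] [Fintype ι₁]
  [DecidableEq ι₁] [Fintype ι₂] [DecidableEq ι₂] {p : ℕ} {ζ u : T}

/-- Induction on the layer `s = ∑ a i mod (p - 1)`. Modulo `λ ^ (s + 1)`, with `λ = ζ - 1`, lower
layers vanish because their coefficients are divisible by `p`, higher ones because of their power of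
`λ`. Cancelling `λ ^ s` leaves a polynomial identity on a grid in `T ⧸ P`. -/
theorem dvd_of_forall_grid_sum_dvd (hp : p.Prime)
    (hζ1 : ζ ≠ 1) (hu : IsUnit u) (hζu : (ζ - 1) ^ (p - 1) = p * u) {P : Ideal T} [hP : P.IsPrime]
    (hζP : ζ - 1 ∈ P) {w ω : ι₁ → T} (hω : ∀ i, ω i ∉ P) {κ : ι₂ → T}
    (hres : ∀ γ : (ι₂ → Fin p) → S, ∑ b, algebraMap S T (γ b) * ∏ i, κ i ^ (b i : ℕ) ∈ P →
      ∀ b, (p : S) ∣ γ b)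
    {γ : (ι₁ → Fin p) → (ι₂ → Fin p) → S}
    (h : ∀ j : ι₁ → Fin p, (p : T) ∣ ∑ a, (∑ b, algebraMap S T (γ a b) * ∏ i, κ i ^ (b i : ℕ)) *
      (∏ i, (w i + ω i * ∑ l ∈ Finset.range (j i), ζ ^ l) ^ (a i : ℕ)) *
      ((ζ - 1) ^ ((∑ i, (a i : ℕ)) % (p - 1)) * u ^ ((∑ i, (a i : ℕ)) / (p - 1)))) :
    ∀ a b, (p : S) ∣ γ a b := by
  classical
  have hp1 : 0 < p - 1 := by have := hp.two_le; omega
  have hl0 : ζ - 1 ≠ 0 := sub_ne_zero.2 hζ1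
  have hpP : (p : T) ∈ P := by
    have : (p : T) * u ∈ P := hζu ▸ P.pow_mem_of_mem hζP _ hp1
    exact (hP.mem_or_mem this).resolve_right fun h => hP.ne_top (P.eq_top_of_isUnit_mem h hu)
  set lam := ζ - 1 with hlam
  suffices hs : ∀ s, ∀ a : ι₁ → Fin p, (∑ i, (a i : ℕ)) % (p - 1) < s → ∀ b, (p : S) ∣ γ a b from
    fun a => hs (p - 1) a (Nat.mod_lt _ hp1)
  intro s
  induction s with
  | zero => intro a ha; omega
  | succ s ih =>
    intro a₀ ha₀
    by_cases hlt : (∑ i, (a₀ i : ℕ)) % (p - 1) < s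
    · exact ih a₀ hlt
    have hs : s < p - 1 := lt_of_le_of_lt (by omega) (Nat.mod_lt (∑ i, (a₀ i : ℕ)) hp1)
    -- This needs `s + 1 ≤ p - 1`, which is why layers are residues modulo `p - 1`.
    have hplam : lam ^ (s + 1) ∣ (p : T) := by
      obtain ⟨v, rfl⟩ := hu
      have : (p : T) = lam ^ (p - 1) * ↑v⁻¹ := by rw [hζu, mul_assoc, Units.mul_inv, mul_one]
      rw [this]
      exact (pow_dvd_pow _ (by omega)).mul_right _
    set δ : (ι₁ → Fin p) → T := fun a => ∑ b, algebraMap S T (γ a b) * ∏ i, κ i ^ (b i : ℕ) with hδ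
    let q := Ideal.Quotient.mk P
    have hq : ∀ {t : T}, q t = 0 ↔ t ∈ P := Ideal.Quotient.eq_zero_iff_mem
    let c : (ι₁ → Fin p) → T ⧸ P := fun a =>
      if (∑ i, (a i : ℕ)) % (p - 1) = s then q (δ a) * q (u ^ ((∑ i, (a i : ℕ)) / (p - 1))) else 0
    have hchar : ((p : ℕ) : T ⧸ P) = 0 := by
      rw [← map_natCast q]; exact hq.2 hpP
    have hCP : CharP (T ⧸ P) p := (CharP.charP_iff_prime_eq_zero hp).2 hchar
    have hgeom : ∀ k : ℕ, q (∑ l ∈ Finset.range k, ζ ^ l) = k := by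
      intro k
      have hζ' : q ζ = 1 := by
        have := hq.2 hζP
        rw [hlam, map_sub, map_one] at this
        exact sub_eq_zero.1 this
      simp [hζ']
    have hc : c a₀ = 0 := by
      -- The geometric sums reduce to `0, …, p - 1`. As `ω i ∉ P` and the characteristic is `p`,
      -- these are `p` distinct points.
      refine eq_zero_of_forall_grid_sum_eq_zero
        (x := fun i k => q (w i) + q (ω i) * ((k : ℕ) : T ⧸ P)) ?_ ?_ a₀
      · intro i k l hkl
        have h1 := mul_left_cancel₀ (fun h => hω i (hq.1 h)) (add_left_cancel hkl)
        have h2 := (CharP.natCast_eq_natCast (T ⧸ P) p).1 h1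
        exact Fin.ext (Nat.ModEq.eq_of_lt_of_lt h2 k.2 l.2)
      · intro j
        set B : (ι₁ → Fin p) → T := fun a =>
          ∏ i, (w i + ω i * ∑ l ∈ Finset.range (j i), ζ ^ l) ^ (a i : ℕ) with hB
        have hterm : ∀ a : ι₁ → Fin p, ∃ y : T,
            δ a * B a * (lam ^ ((∑ i, (a i : ℕ)) % (p - 1)) *
              u ^ ((∑ i, (a i : ℕ)) / (p - 1))) = lam ^ s * y ∧
            q y = c a * q (B a) := by
          intro a
          rcases lt_trichotomy ((∑ i, (a i : ℕ)) % (p - 1)) s with hlt | heq | hgt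
          · have hd : (p : T) ∣ δ a := by
              refine Finset.dvd_sum fun b _ => ?_
              have := map_dvd (algebraMap S T) (ih a hlt b)
              rw [map_natCast] at this
              exact this.mul_right _
            obtain ⟨y, hy⟩ := hplam.trans hd
            refine ⟨lam * y * B a * (lam ^ ((∑ i, (a i : ℕ)) % (p - 1)) *
              u ^ ((∑ i, (a i : ℕ)) / (p - 1))), by rw [hy]; ring, ?_⟩
            simp only [c, if_neg hlt.ne, zero_mul, map_mul, hq.2 hζP]
          · refine ⟨δ a * u ^ ((∑ i, (a i : ℕ)) / (p - 1)) * B a, by rw [heq]; ring, ?_⟩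
            simp only [c, if_pos heq, map_mul]
          · obtain ⟨k, hk⟩ := Nat.exists_eq_add_of_lt hgt
            refine ⟨lam * (lam ^ k * δ a * B a * u ^ ((∑ i, (a i : ℕ)) / (p - 1))),
              by rw [hk]; ring, ?_⟩
            simp only [c, if_neg hgt.ne', zero_mul, map_mul, hq.2 hζP]
        choose y hy hqy using hterm
        have hdvd := hplam.trans (h j)
        change lam ^ (s + 1) ∣ ∑ a, δ a * B a * _ at hdvd
        simp_rw [hy] at hdvd
        rw [← Finset.mul_sum, pow_succ, mul_dvd_mul_iff_left (pow_ne_zero _ hl0)] at hdvd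
        have h0 : q (∑ a, y a) = 0 := hq.2 (P.mem_of_dvd hdvd hζP)
        rw [← h0, map_sum]
        refine Finset.sum_congr rfl fun a _ => ?_
        rw [hqy, hB, map_prod]
        congr 1
        refine Finset.prod_congr rfl fun i _ => ?_
        rw [map_pow, map_add, map_mul, hgeom]
    have heq : (∑ i, (a₀ i : ℕ)) % (p - 1) = s := by omega
    simp only [c, if_pos heq, ← map_mul, hq] at hc
    refine hres (γ a₀) ((hP.mem_or_mem hc).resolve_right fun h => ?_)
    exact hP.ne_top (P.eq_top_of_isUnit_mem h (hu.pow _))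

end

/-! ### Integrality of the scaled differences, and linear disjointness modulo `p` -/

/-- If `ω ^ p = h ^ p + p ^ 2 * a` then `(ω - h) ^ (p - 1) / p` is integral. -/
theorem isIntegral_of_mul_eq_sub_pow {S Ω : Type*} [CommRing S] [Field Ω] [Algebra S Ω]
    {p : ℕ} (hp : p.Prime) (hp0 : (p : Ω) ≠ 0) {ω : Ω} {f h a : S}
    (hω : ω ^ p = algebraMap S Ω f) (hf : f - h ^ p = p ^ 2 * a) {y : Ω}
    (hy : p * y = (ω - algebraMap S Ω h) ^ (p - 1)) : IsIntegral S y := by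
  let T := integralClosure S Ω
  have hωint : IsIntegral S ω := IsIntegral.of_pow hp.pos (hω ▸ isIntegral_algebraMap)
  let x : T := ⟨ω, hωint⟩ - algebraMap S T h
  obtain ⟨n, rfl⟩ : ∃ n, p = n + 2 := ⟨p - 2, by have := hp.two_le; omega⟩
  obtain ⟨r, hr⟩ := exists_add_pow_prime_eq hp x (algebraMap S T h)
  have hxω : x + algebraMap S T h = ⟨ω, hωint⟩ := by simp [x]
  have hx : (x : Ω) = ω - algebraMap S Ω h := rfl
  rw [hxω] at hr
  have hr' := congrArg (algebraMap T Ω) hr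
  have e1 : ∀ s : S, algebraMap T Ω (algebraMap S T s) = algebraMap S Ω s := fun s => rfl
  have hpΩ : algebraMap S Ω ((n + 2 : ℕ) : S) = ((n + 2 : ℕ) : Ω) := map_natCast _ _
  have hf' := congrArg (algebraMap S Ω) hf
  simp only [map_pow, map_add, map_mul, map_natCast, e1, map_sub] at hr' hf'
  change ω ^ (n + 2) = (x : Ω) ^ (n + 2) + _ + _ * (x : Ω) * _ * (r : Ω) at hr'
  rw [hω] at hr'
  rw [show n + 2 - 1 = n + 1 by omega, ← hx] at hy
  -- With `x = ω - h`, expanding `(x + h) ^ p` gives `θ x = p a`. Hence `θ ^ 2 = h r θ + x ^ (p - 2)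
  -- a`, a monic quadratic equation over the integral elements.
  set θ : Ω := y + algebraMap S Ω h * r with hθ
  have h1 : θ * x = ((n + 2 : ℕ) : Ω) * algebraMap S Ω a := by
    apply mul_left_cancel₀ hp0
    calc ((n + 2 : ℕ) : Ω) * (θ * x)
        = ((n + 2 : ℕ) : Ω) * y * x +
          ((n + 2 : ℕ) : Ω) * (x : Ω) * algebraMap S Ω h * r := by rw [hθ]; ring
      _ = algebraMap S Ω f - algebraMap S Ω h ^ (n + 2) := by rw [hy, hr']; ring
      _ = _ := by rw [hf']; ring
  have h2 : θ ^ 2 = algebraMap S Ω h * r * θ + (x : Ω) ^ n * algebraMap S Ω a := by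
    apply mul_left_cancel₀ hp0
    calc ((n + 2 : ℕ) : Ω) * θ ^ 2
        = (((n + 2 : ℕ) : Ω) * y + ((n + 2 : ℕ) : Ω) * (algebraMap S Ω h * r)) * θ := by
          rw [hθ]; ring
      _ = (x : Ω) ^ n * (θ * x) + ((n + 2 : ℕ) : Ω) * (algebraMap S Ω h * r) * θ := by
          rw [hy]; ring
      _ = _ := by rw [h1]; ring
  have hθint : IsIntegral T θ := by
    refine ⟨Polynomial.X ^ 2 - Polynomial.C (algebraMap S T h * r) * Polynomial.X
      - Polynomial.C (x ^ n * algebraMap S T a), ?_, ?_⟩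
    · monicity!
    · simp only [Polynomial.eval₂_sub, Polynomial.eval₂_mul, Polynomial.eval₂_pow,
        Polynomial.eval₂_C, Polynomial.eval₂_X, map_mul, map_pow, e1]
      rw [h2]
      change _ + (x : Ω) ^ n * _ - _ * (r : Ω) * _ - (x : Ω) ^ n * _ = 0
      ring
  have hθS : IsIntegral S θ := isIntegral_trans θ hθint
  have : y = θ - algebraMap S Ω h * r := by rw [hθ]; ring
  rw [this]
  exact hθS.sub (isIntegral_algebraMap.mul r.2)

/-- A dimension count, so any linear isomorphism suffices: each factor has degree `p`, and the box
monomials are a spanning set whose size is the dimension. -/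
theorem linearIndependent_box_of_piTensorProduct_equiv {F Ω ι : Type*} [Field F] [Field Ω]
    [Algebra F Ω] [Fintype ι] [DecidableEq ι] {p : ℕ} (hp : p.Prime) {g : ι → F}
    (hg : ∀ j, ¬ ∃ a : F, a ^ p = g j) {β : ι → Ω} (hβ : ∀ j, β j ^ p = algebraMap F Ω (g j))
    (e : PiTensorProduct F (fun j => IntermediateField.adjoin F {β j}) ≃ₗ[F]
      IntermediateField.adjoin F (Set.range β)) :
    LinearIndependent F fun b : ι → Fin p => ∏ i, β i ^ (b i : ℕ) := by
  have hint : ∀ j, IsIntegral F (β j) := fun j =>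
    IsIntegral.of_pow hp.pos (hβ j ▸ isIntegral_algebraMap)
  have hrank : ∀ j, Module.finrank F (IntermediateField.adjoin F {β j}) = p := by
    intro j
    have hmin : minpoly F (β j) = Polynomial.X ^ p - Polynomial.C (g j) :=
      (minpoly.eq_of_irreducible_of_monic
        (X_pow_sub_C_irreducible_of_prime hp fun b hb => hg j ⟨b, hb⟩) (by simp [hβ])
        (Polynomial.monic_X_pow_sub_C _ hp.ne_zero)).symm
    rw [IntermediateField.adjoin.finrank (hint j), hmin, Polynomial.natDegree_X_pow_sub_C]
  have hfin : ∀ j, FiniteDimensional F (IntermediateField.adjoin F {β j}) := fun j =>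
    IntermediateField.adjoin.finiteDimensional (hint j)
  have hcard : Module.finrank F (IntermediateField.adjoin F (Set.range β)) =
      Fintype.card (ι → Fin p) := by
    rw [← e.finrank_eq, Module.finrank_eq_card_basis
      (Basis.piTensorProduct fun j => Module.finBasisOfFinrankEq F _ (hrank j))]
  have halg : (IntermediateField.adjoin F (Set.range β)).toSubalgebra =
      Algebra.adjoin F (Set.range β) := by
    refine IntermediateField.adjoin_toSubalgebra_of_isAlgebraic ?_
    rintro _ ⟨j, rfl⟩
    exact (hint j).isAlgebraic
  have hspan : Submodule.span F (Set.range fun b : ι → Fin p => ∏ i, β i ^ (b i : ℕ)) =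
      Subalgebra.toSubmodule (IntermediateField.adjoin F (Set.range β)).toSubalgebra := by
    refine le_antisymm ?_ ?_
    · rw [Submodule.span_le]
      rintro _ ⟨b, rfl⟩
      rw [SetLike.mem_coe, Subalgebra.mem_toSubmodule]
      refine prod_mem fun i _ => pow_mem ?_ _
      exact IntermediateField.subset_adjoin F _ ⟨i, rfl⟩
    · rw [halg]
      refine Algebra.adjoin_range_le_span_box hp.pos fun i => ?_
      rw [hβ, Algebra.algebraMap_eq_smul_one]
      exact Submodule.smul_mem _ _ (Submodule.subset_span ⟨⟨0, hp.pos⟩, by simp⟩)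
  rw [linearIndependent_iff_card_eq_finrank_span, Set.finrank, hspan, ← hcard]
  rfl

/-- In characteristic `p` a `p`-th root is unique, so the `β j` and `κ j` agree in a common
algebraic closure. -/
theorem linearIndependent_box_of_pow_eq {F Ω k ι : Type*} [Field F] [Field Ω] [Field k]
    [Algebra F Ω] [Algebra F k] [IsAlgClosed Ω] [Algebra.IsAlgebraic F Ω] [Fintype ι] [DecidableEq ι] {p : ℕ}
    (hp : p.Prime) [CharP F p] {g : ι → F} {β : ι → Ω} (hβ : ∀ j, β j ^ p = algebraMap F Ω (g j))
    (hind : LinearIndependent F fun b : ι → Fin p => ∏ i, β i ^ (b i : ℕ))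
    {κ : ι → k} (hκ : ∀ j, κ j ^ p = algebraMap F k (g j)) :
    LinearIndependent F fun b : ι → Fin p => ∏ i, κ i ^ (b i : ℕ) := by
  have : Fact p.Prime := ⟨hp⟩
  let φ : Ω →ₐ[F] AlgebraicClosure k := IsAlgClosed.lift
  have : CharP k p := charP_of_injective_algebraMap (algebraMap F k).injective p
  have : CharP (AlgebraicClosure k) p :=
    charP_of_injective_algebraMap (algebraMap k (AlgebraicClosure k)).injective p
  let ψ : k →ₐ[F] AlgebraicClosure k := IsScalarTower.toAlgHom F k (AlgebraicClosure k)
  have hφψ : ∀ j, φ (β j) = ψ (κ j) := by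
    intro j
    apply frobenius_inj (AlgebraicClosure k) p
    rw [frobenius_def, frobenius_def, ← map_pow, ← map_pow, hβ, hκ, AlgHom.commutes,
      AlgHom.commutes]
  have h1 := hind.map' φ.toLinearMap (LinearMap.ker_eq_bot.2 φ.injective)
  have h2 : (ψ.toLinearMap ∘ fun b : ι → Fin p => ∏ i, κ i ^ (b i : ℕ)) =
      φ.toLinearMap ∘ fun b : ι → Fin p => ∏ i, β i ^ (b i : ℕ) := by
    funext b
    simp [hφψ]
  rw [← h2] at h1
  exact LinearIndependent.of_comp _ h1

/-- The monomials in `p`-th roots of elements linearly disjoint modulo `p` have no relations modulo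
a prime over `p`. -/
theorem LinearlyDisjointModP.dvd_of_sum_mem {S : Type*} [CommRing S] {p : ℕ} (hp : p.Prime)
    (hpS : Prime (p : S)) {F : Type*} [Field F] [Algebra (S ⧸ Ideal.span {(p : S)}) F]
    [IsFractionRing (S ⧸ Ideal.span {(p : S)}) F] {ι : Type*} [Fintype ι] [DecidableEq ι] {g : ι → S}
    (hg : LinearlyDisjointModP p F g) {T : Type*} [CommRing T] [Algebra S T] {P : Ideal T}
    [hP : P.IsPrime] (hPS : P.comap (algebraMap S T) = Ideal.span {(p : S)}) {κ : ι → T}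
    (hκ : ∀ j, κ j ^ p = algebraMap S T (g j)) (γ : (ι → Fin p) → S)
    (h : ∑ b, algebraMap S T (γ b) * ∏ i, κ i ^ (b i : ℕ) ∈ P) (b : ι → Fin p) :
    (p : S) ∣ γ b := by
  obtain ⟨hnot, β, hβ, ⟨e⟩⟩ := hg
  have hI : (Ideal.span {(p : S)}).IsPrime := (Ideal.span_singleton_prime hpS.ne_zero).2 hpS
  have hchar : ((p : ℕ) : F) = 0 := by
    rw [← map_natCast (algebraMap (S ⧸ Ideal.span {(p : S)}) F), ← map_natCast
      (Ideal.Quotient.mk (Ideal.span {(p : S)})), Ideal.Quotient.eq_zero_iff_mem.2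
        (Ideal.mem_span_singleton_self _), map_zero]
  have : CharP F p := (CharP.charP_iff_prime_eq_zero hp).2 hchar
  -- `F` embeds in this residue field because `P` contracts to `(p)`; the relation becomes one
  -- between box monomials over `F`.
  let k := FractionRing (T ⧸ P)
  let φ₀ : S ⧸ Ideal.span {(p : S)} →+* T ⧸ P := Ideal.quotientMap P (algebraMap S T) hPS.ge
  have hφ₀ : Function.Injective φ₀ := Ideal.quotientMap_injective' hPS.le
  let φ₁ : S ⧸ Ideal.span {(p : S)} →+* k := (algebraMap (T ⧸ P) k).comp φ₀
  have hφ₁ : Function.Injective φ₁ := (IsFractionRing.injective (T ⧸ P) k).comp hφ₀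
  let φ : F →+* k := IsFractionRing.lift hφ₁
  have hφ : ∀ s : S, φ (algebraMap _ F (Ideal.Quotient.mk (Ideal.span {(p : S)}) s)) =
      algebraMap (T ⧸ P) k (Ideal.Quotient.mk P (algebraMap S T s)) := by
    intro s
    rw [IsFractionRing.lift_algebraMap]
    rfl
  let := φ.toAlgebra
  have hind := linearIndependent_box_of_pow_eq hp hβ
    (linearIndependent_box_of_piTensorProduct_equiv hp hnot hβ e)
    (κ := fun j => algebraMap (T ⧸ P) k (Ideal.Quotient.mk P (κ j))) (fun j => by
      rw [← map_pow, ← map_pow, hκ]; exact (hφ _).symm)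
  have h0 := Fintype.linearIndependent_iff.1 hind
    (fun b => algebraMap _ F (Ideal.Quotient.mk (Ideal.span {(p : S)}) (γ b))) (by
      have h1 := congrArg (algebraMap (T ⧸ P) k) (Ideal.Quotient.eq_zero_iff_mem.2 h)
      rw [map_zero] at h1
      rw [← h1, map_sum, map_sum]
      refine Finset.sum_congr rfl fun b _ => ?_
      rw [Algebra.smul_def, map_mul, map_mul, map_prod, map_prod]
      simp_rw [map_pow]
      congr 1
      exact hφ _) b
  rw [map_eq_zero_iff _ (IsFractionRing.injective (S ⧸ Ideal.span {(p : S)}) F),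
    Ideal.Quotient.eq_zero_iff_mem, Ideal.mem_span_singleton] at h0
  exact h0

theorem charZero_of_prime_natCast {S : Type*} [CommRing S] [IsDomain S] {p : ℕ} (hp : p.Prime)
    (hpS : Prime (p : S)) : CharZero S := by
  obtain ⟨q, hq⟩ := CharP.exists S
  rcases CharP.char_is_prime_or_zero S q with hqp | rfl
  · exfalso
    have hne : p.Coprime q := (Nat.coprime_primes hp hqp).2 fun h => by
      exact hpS.ne_zero (by rw [h]; exact CharP.cast_eq_zero S q)
    have h := Nat.isCoprime_iff_coprime.2 hne
    obtain ⟨a, b, hab⟩ := h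
    have h1 := congrArg (Int.cast : ℤ → S) hab
    push_cast at h1
    rw [CharP.cast_eq_zero S q, mul_zero, add_zero] at h1
    exact hpS.not_isUnit (IsUnit.of_mul_eq_one_right _ h1)
  · exact CharP.charP_to_charZero S

/-- Frobenius is injective on `T ⧸ P`, so `∏ κ j ^ e j ≡ c` modulo `P`. Unless `e = 0`, this is a
relation between distinct box monomials with a coefficient `1`. -/
theorem LinearlyDisjointModP.exponent_eq_zero {S : Type*} [CommRing S] {p : ℕ} (hp : p.Prime)
    (hpS : Prime (p : S)) {F : Type*} [Field F] [Algebra (S ⧸ Ideal.span {(p : S)}) F]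
    [IsFractionRing (S ⧸ Ideal.span {(p : S)}) F] {ι : Type*} [Fintype ι] [DecidableEq ι]
    {g : ι → S} (hg : LinearlyDisjointModP p F g) {T : Type*} [CommRing T] [Algebra S T]
    {P : Ideal T} [hP : P.IsPrime] (hPS : P.comap (algebraMap S T) = Ideal.span {(p : S)})
    {κ : ι → T} (hκ : ∀ j, κ j ^ p = algebraMap S T (g j)) {e : ι → ℕ} (he : ∀ j, e j < p)
    {c : S} (hc : ∏ j, g j ^ e j = c ^ p) (j : ι) : e j = 0 := by
  have hpP : (p : T) ∈ P := by
    have : (p : S) ∈ P.comap (algebraMap S T) := hPS ▸ Ideal.mem_span_singleton_self _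
    simpa using this
  have hchar : CharP (T ⧸ P) p := (CharP.charP_iff_prime_eq_zero hp).2 (by
    rw [← map_natCast (Ideal.Quotient.mk P)]; exact Ideal.Quotient.eq_zero_iff_mem.2 hpP)
  have : Fact p.Prime := ⟨hp⟩
  have hmem : ∏ j, κ j ^ e j - algebraMap S T c ∈ P := by
    rw [← Ideal.Quotient.eq_zero_iff_mem]
    refine pow_eq_zero_iff hp.ne_zero |>.1 ?_
    rw [map_sub, sub_pow_char, ← map_pow, ← map_pow, ← map_pow, ← hc, ← Finset.prod_pow,
      map_prod (algebraMap S T), sub_eq_zero]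
    congr 1
    refine Finset.prod_congr rfl fun j _ => ?_
    rw [map_pow, ← hκ]; ring
  let e' : ι → Fin p := fun j => ⟨e j, he _⟩
  let z' : ι → Fin p := fun _ => ⟨0, hp.pos⟩
  have hsingle : ∀ (a : ι → Fin p) (x : S), ∑ b : ι → Fin p,
      algebraMap S T ((Pi.single a x : (ι → Fin p) → S) b) * ∏ i, κ i ^ (b i : ℕ) =
        algebraMap S T x * ∏ i, κ i ^ (a i : ℕ) := by
    intro a x
    rw [Finset.sum_eq_single a] <;> simp +contextual
  have hdvd := hg.dvd_of_sum_mem hp hpS hPS hκ (Pi.single e' 1 - Pi.single z' c) (by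
    simp only [Pi.sub_apply, map_sub, sub_mul, Finset.sum_sub_distrib, hsingle]
    simpa [e', z'] using hmem) e'
  have hez : e' = z' := by
    by_contra hne
    rw [Pi.sub_apply, Pi.single_eq_same, Pi.single_eq_of_ne hne, sub_zero] at hdvd
    exact hpS.not_isUnit (isUnit_of_dvd_one hdvd)
  exact congrArg Fin.val (congrFun hez j)

/-! ### Galois action on the tower, and coefficients up to powers of `p` -/

section Tower

variable {S : Type*} [CommRing S] [IsDomain S] [IsNoetherianRing S]
  {p : ℕ} {F : Type*} [Field F] [Algebra (S ⧸ Ideal.span {(p : S)}) F]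
  {ι₁ ι₂ : Type*} {f : ι₁ → S} {g : ι₂ → S}

theorem elim_ne_zero_of_linearlyDisjointModP (hp : p.Prime) (hpS : Prime (p : S))
    (hf : IsClassOneTower p f) (hdisj : LinearlyDisjointModP p F g) (i : ι₁ ⊕ ι₂) :
    Sum.elim f g i ≠ 0 := by
  rcases i with i | j
  · intro h
    exact (hf.squareFree i).not_dvd_of_mem_pthPowersModSq hp hpS (hf.mem_pthPowersModSq i)
      ((show f i = 0 from h) ▸ dvd_zero _)
  · intro h
    exact hdisj.1 j ⟨0, by rw [show g j = 0 from h, map_zero, map_zero, zero_pow hp.ne_zero]⟩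

variable [IsFractionRing (S ⧸ Ideal.span {(p : S)}) F] [Fintype ι₁] [Fintype ι₂]
  [DecidableEq ι₂]

theorem exists_prime_integralClosure_over {S Ω : Type*} [CommRing S] [Field Ω] [Algebra S Ω]
    [FaithfulSMul S Ω] (I : Ideal S) [I.IsPrime] :
    ∃ P : Ideal (integralClosure S Ω), P.IsPrime ∧
      P.comap (algebraMap S (integralClosure S Ω)) = I := by
  obtain ⟨P, -, hP, hPI⟩ := Ideal.exists_ideal_over_prime_of_isIntegral
    (S := integralClosure S Ω) I ⊥ (by
      intro x hx
      rw [Ideal.mem_comap, Ideal.mem_bot] at hx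
      have h1 := congrArg Subtype.val hx
      have h2 : algebraMap S Ω x = 0 := h1
      rw [(FaithfulSMul.algebraMap_injective S Ω).eq_iff' (map_zero _)] at h2
      exact h2 ▸ I.zero_mem)
  exact ⟨P, hP, hPI⟩

/-- Multiplicative independence modulo `p`-th powers. -/
theorem exponents_eq_zero_of_prod_eq_pow (hp : p.Prime) (hpS : Prime (p : S))
    (hf : IsClassOneTower p f) (hA : SatisfiesA1 (Sum.elim f g))
    (hdisj : LinearlyDisjointModP p F g) {Ω : Type*} [Field Ω] [Algebra S Ω] [FaithfulSMul S Ω]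
    {κ : ι₂ → Ω} (hκ : ∀ j, κ j ^ p = algebraMap S Ω (g j)) {e : ι₁ ⊕ ι₂ → ℕ}
    (he : ∀ i, e i < p) {c : S} (hc : ∏ i, Sum.elim f g i ^ e i = c ^ p) (i : ι₁ ⊕ ι₂) :
    e i = 0 := by
  have h1 : ∀ i, e (Sum.inl i) = 0 := by
    intro i
    have hnd := (hf.squareFree i).not_dvd_of_mem_pthPowersModSq hp hpS (hf.mem_pthPowersModSq i)
    obtain ⟨Q, hQp, hQ1, hQ⟩ := exists_height_eq_one_of_not_isUnit (x := f i)
      (fun h => hnd (h ▸ dvd_zero _)) (hf.not_isUnit i)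
    exact exponent_eq_zero_of_prod_eq_pow hA hc (i := Sum.inl i) (hf.squareFree i) (he _) hQ1 hQ
  -- The `g j` may be units, so height one primes need not detect their exponents; reduction modulo
  -- `p` does.
  have h2 : ∏ j, g j ^ e (Sum.inr j) = c ^ p := by
    rw [← hc, Fintype.prod_sum_type]
    simp [h1]
  have hI : (Ideal.span {(p : S)}).IsPrime := (Ideal.span_singleton_prime hpS.ne_zero).2 hpS
  obtain ⟨P, hP, hPS⟩ := exists_prime_integralClosure_over (Ω := Ω) (Ideal.span {(p : S)})
  rcases i with i | j
  · exact h1 i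
  · exact hdisj.exponent_eq_zero hp hpS hPS
      (κ := fun j => ⟨κ j, IsIntegral.of_pow hp.pos (hκ j ▸ isIntegral_algebraMap)⟩)
      (fun j => Subtype.ext (hκ j)) (fun j => he (Sum.inr j)) h2 j

variable [IsIntegrallyClosed S] {L : Type*} [Field L] [Algebra S L] [IsFractionRing S L] {Ω : Type*} [Field Ω]
  [Algebra L Ω] [Algebra S Ω] [IsScalarTower S L Ω] {ω : ι₁ → Ω} {κ : ι₂ → Ω} {ζ : Ω}

/-- Kummer theory over `L(ζ)`. A monomial lying in `L(ζ)` has its `p`-th power already a `p`-th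
power in `L`, hence in `S` by normality, and multiplicative independence applies. -/
theorem exists_algHom_apply_eq_pow_mul [CharZero L] [IsAlgClosed Ω] [Algebra.IsAlgebraic L Ω]
    (hp : p.Prime) (hpS : Prime (p : S))
    (hf : IsClassOneTower p f) (hA : SatisfiesA1 (Sum.elim f g))
    (hdisj : LinearlyDisjointModP p F g) (hω : ∀ i, ω i ^ p = algebraMap S Ω (f i))
    (hκ : ∀ j, κ j ^ p = algebraMap S Ω (g j)) (hζ : IsPrimitiveRoot ζ p) (j : ι₁ ⊕ ι₂ → ℕ) :
    ∃ σ : Ω →ₐ[L] Ω, σ ζ = ζ ∧ ∀ i, σ (Sum.elim ω κ i) = ζ ^ j i * Sum.elim ω κ i := by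
  have hinj : Function.Injective (algebraMap S Ω) := by
    rw [IsScalarTower.algebraMap_eq S L Ω]
    exact (algebraMap L Ω).injective.comp (IsFractionRing.injective S L)
  have : FaithfulSMul S Ω := (faithfulSMul_iff_algebraMap_injective S Ω).2 hinj
  have hW : ∀ i, Sum.elim ω κ i ^ p = algebraMap S Ω (Sum.elim f g i) := by
    rintro (i | i)
    · exact hω i
    · exact hκ i
  have hexp := fun (e : ι₁ ⊕ ι₂ → ℕ) (he : ∀ i, e i < p) (c : S) =>
    exponents_eq_zero_of_prod_eq_pow hp hpS hf hA hdisj hκ he (c := c)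
  have hW0 : ∀ i, Sum.elim ω κ i ≠ 0 := fun i h => by
    have h1 := hW i
    rw [h, zero_pow hp.ne_zero] at h1
    exact elim_ne_zero_of_linearlyDisjointModP hp hpS hf hdisj i
      (hinj (h1.symm.trans (map_zero _).symm))
  let M := IntermediateField.adjoin L {ζ}
  have hζM : ζ ∈ M := IntermediateField.mem_adjoin_simple_self L ζ
  let ζM : M := ⟨ζ, hζM⟩
  have hζM' : IsPrimitiveRoot ζM p := IsPrimitiveRoot.of_map_of_injective (f := algebraMap M Ω) hζ
    (algebraMap M Ω).injective
  have : CharZero M := charZero_of_injective_algebraMap (algebraMap L M).injective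
  have : Algebra.IsAlgebraic M Ω := Algebra.IsAlgebraic.tower_top (K := L) M
  have : IsAlgClosure M Ω := ⟨inferInstance, inferInstance⟩
  have : Normal M Ω := IsAlgClosure.normal M Ω
  have : IsGalois M Ω := {}
  obtain ⟨σ, hσ⟩ := exists_algEquiv_apply_eq_pow_mul hp hζM' hW0 (fun i =>
    ⟨algebraMap L M (algebraMap S L (Sum.elim f g i)), by
      rw [hW, ← IsScalarTower.algebraMap_apply L M Ω, ← IsScalarTower.algebraMap_apply S L Ω]⟩)
    (fun e he hr => by
      obtain ⟨x, hx⟩ := hr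
      obtain ⟨b, hb⟩ := exists_pow_eq_of_pow_eq_adjoin_primitiveRoot hp hζ x.2
        (v := algebraMap S L (∏ i, Sum.elim f g i ^ e i)) (by
          have : (x : Ω) = ∏ i, Sum.elim ω κ i ^ e i := hx
          rw [this, ← IsScalarTower.algebraMap_apply S L Ω, map_prod, ← Finset.prod_pow]
          refine Finset.prod_congr rfl fun i _ => ?_
          rw [map_pow, ← hW]; ring)
      obtain ⟨c, rfl⟩ := (IsIntegrallyClosed.isIntegral_iff (R := S) (K := L)).1
        (IsIntegral.of_pow hp.pos (x := b) (hb ▸ isIntegral_algebraMap))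
      refine hexp e he c (IsFractionRing.injective S L ?_)
      rw [← hb, map_pow]) j
  refine ⟨σ.toAlgHom.restrictScalars L, ?_, hσ⟩
  exact σ.commutes ζM

/-- Coefficients of an integral element with respect to the monomials in the `p`-th roots become
integral after multiplication by a power of `p`. -/
theorem isIntegral_coeff_of_sum [DecidableEq ι₁] (hp : p.Prime) {W : ι₁ → Ω}
    (hsq : ∀ i, IsSquareFreeElem (f i)) (hA : SatisfiesA1 f)
    (hW : ∀ i, W i ^ p = algebraMap S Ω (f i)) (hζ : IsPrimitiveRoot ζ p)
    (hσ : ∀ j : ι₁ → ℕ, ∃ σ : Ω →ₐ[L] Ω, ∀ i, σ (W i) = ζ ^ j i * W i)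
    {c : (ι₁ → Fin p) → L} (hc : IsIntegral S (∑ k, c k • ∏ i, W i ^ (k i : ℕ)))
    (m : ι₁ → Fin p) :
    (p : L) ^ Fintype.card ι₁ * c m ∈ Set.range (algebraMap S L) := by
  choose σ hσ using fun j : ι₁ → Fin p => hσ fun i => j i
  have hζint : IsIntegral S ζ := (hζ.isIntegral hp.pos).tower_top
  have hsum := sum_pow_mul_algHom_apply hζ hσ c m
  have hint : IsIntegral S ((p : Ω) ^ Fintype.card ι₁ * (c m • ∏ i, W i ^ (m i : ℕ))) := by
    rw [← hsum]
    refine IsIntegral.sum _ fun j _ => IsIntegral.mul ?_ ?_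
    · exact IsIntegral.prod _ fun i _ => (hζint.pow _).pow _
    · exact hc.map ((σ j).restrictScalars S)
  -- Taking the `p`-th power of the isolated term turns the roots `W i` into the `f i` and brings
  -- the statement down to `L`.
  refine mem_range_of_pow_mul_prod_mem_range hsq hA hp.pos (fun i => (m i).2)
    (IsIntegrallyClosed.isIntegral_iff.1 ?_)
  rw [← isIntegral_algebraMap_iff (algebraMap L Ω).injective]
  convert hint.pow p using 1
  rw [map_mul, ← IsScalarTower.algebraMap_apply S L Ω, map_prod, map_pow, map_mul, map_pow,
    map_natCast, Algebra.smul_def, ← mul_assoc, mul_pow _ (∏ i, _), ← Finset.prod_pow]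
  congr 1
  refine Finset.prod_congr rfl fun i _ => ?_
  rw [map_pow, ← hW]; ring

theorem linearIndependent_monomials [CharZero L] [DecidableEq ι₁] (hp : p.Prime) {W : ι₁ → Ω}
    (hW0 : ∀ i, W i ≠ 0) (hζ : IsPrimitiveRoot ζ p)
    (hσ : ∀ j : ι₁ → ℕ, ∃ σ : Ω →ₐ[L] Ω, ∀ i, σ (W i) = ζ ^ j i * W i) :
    LinearIndependent L fun k : ι₁ → Fin p => ∏ i, W i ^ (k i : ℕ) := by
  have : CharZero Ω := charZero_of_injective_algebraMap (algebraMap L Ω).injective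
  choose σ hσ using fun j : ι₁ → Fin p => hσ fun i => j i
  rw [Fintype.linearIndependent_iff]
  intro c hc m
  have hsum := sum_pow_mul_algHom_apply hζ hσ c m
  rw [hc] at hsum
  simp only [map_zero, mul_zero, Finset.sum_const_zero] at hsum
  rcases mul_eq_zero.1 hsum.symm with h | h
  · exact absurd h (pow_ne_zero _ (Nat.cast_ne_zero.2 hp.ne_zero))
  · exact (smul_eq_zero.1 h).resolve_right
      (Finset.prod_ne_zero_iff.2 fun i _ => pow_ne_zero _ (hW0 i))

end Tower

/-! ### The candidate basis -/

/-- The monomial in `x` and `y` with exponents `m`, divided by the largest power of `p` dividing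
it when each `x i` is divisible by a `(p - 1)`-st root of `p`. -/
noncomputable def scaledMonomial {Ω ι₁ ι₂ : Type*} [Field Ω] [Fintype ι₁] [Fintype ι₂] (p : ℕ)
    (x : ι₁ → Ω) (y : ι₂ → Ω) (m : ι₁ ⊕ ι₂ → Fin p) : Ω :=
  (∏ i, x i ^ (m (Sum.inl i) : ℕ)) * (∏ j, y j ^ (m (Sum.inr j) : ℕ)) /
    (p : Ω) ^ ((∑ i, (m (Sum.inl i) : ℕ)) / (p - 1))

section

variable {Ω ι₁ ι₂ : Type*} [Field Ω] [Fintype ι₁] [Fintype ι₂] {p : ℕ}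

theorem map_scaledMonomial {Ω' : Type*} [Field Ω'] (φ : Ω →+* Ω') (x : ι₁ → Ω) (y : ι₂ → Ω)
    (m : ι₁ ⊕ ι₂ → Fin p) :
    φ (scaledMonomial p x y m) = scaledMonomial p (φ ∘ x) (φ ∘ y) m := by
  simp [scaledMonomial]

/-- Division of `∑ a i` by `p - 1` splits the power of `λ`: the quotient cancels the denominator up
to a unit power, and the remainder is the layer used in the descent. -/
theorem scaledMonomial_eq_algebraMap {T : Type*} [CommRing T] [Algebra T Ω] (hp0 : (p : Ω) ≠ 0)
    {lam u : T} (hl : lam ^ (p - 1) = p * u) {w : ι₁ → T} {y : ι₂ → T} (m : ι₁ ⊕ ι₂ → Fin p) :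
    scaledMonomial p (fun i => algebraMap T Ω (lam * w i)) (fun j => algebraMap T Ω (y j)) m =
      algebraMap T Ω ((∏ j, y j ^ (m (Sum.inr j) : ℕ)) * (∏ i, w i ^ (m (Sum.inl i) : ℕ)) *
        (lam ^ ((∑ i, (m (Sum.inl i) : ℕ)) % (p - 1)) *
          u ^ ((∑ i, (m (Sum.inl i) : ℕ)) / (p - 1)))) := by
  rw [scaledMonomial, div_eq_iff (pow_ne_zero _ hp0)]
  simp_rw [← map_pow, ← map_prod, ← map_natCast (algebraMap T Ω), ← map_pow, ← map_mul]
  congr 1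
  set s := ∑ i, (m (Sum.inl i) : ℕ) with hs
  have h1 : ∏ i, (lam * w i) ^ (m (Sum.inl i) : ℕ) =
      lam ^ s * ∏ i, w i ^ (m (Sum.inl i) : ℕ) := by
    simp_rw [mul_pow, Finset.prod_mul_distrib]
    rw [Finset.prod_pow_eq_pow_sum]
  have h2 : lam ^ s = (p * u) ^ (s / (p - 1)) * lam ^ (s % (p - 1)) := by
    conv_lhs => rw [← Nat.div_add_mod s (p - 1), pow_add, pow_mul, hl]
  rw [h1, h2, mul_pow]
  ring

end

theorem IsIntegralClosure.exists_algebraMap_eq {S T Ω : Type*} [CommRing S] [CommRing T]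
    [Field Ω] [Algebra S Ω] [Algebra T Ω] [IsIntegralClosure T S Ω] {x : Ω}
    (hx : IsIntegral S x) : ∃ t : T, algebraMap T Ω t = x :=
  (IsIntegralClosure.isIntegral_iff (A := T)).1 hx

/-- The `(p - 1)`-st power of `(ω - h) / (ζ - 1)` is `(ω - h) ^ (p - 1) / p` times a unit, hence
integral. -/
theorem exists_sub_one_mul_eq_sub {S T Ω : Type*} [CommRing S] [CommRing T] [Field Ω]
    [Algebra S Ω] [Algebra T Ω] [IsIntegralClosure T S Ω] {p : ℕ} (hp : p.Prime) (hp0 : (p : Ω) ≠ 0) {ζ u : T}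
    (hu : IsUnit u) (hζu : (ζ - 1) ^ (p - 1) = p * u) {f h : S}
    (hf : f - h ^ p ∈ Ideal.span {(p : S) ^ 2}) {ω : Ω} (hω : ω ^ p = algebraMap S Ω f) :
    ∃ w : T, algebraMap T Ω ((ζ - 1) * w) = ω - algebraMap S Ω h := by
  obtain ⟨a, ha⟩ := Ideal.mem_span_singleton'.1 hf
  have hp1 : 0 < p - 1 := by have := hp.two_le; omega
  set lam := algebraMap T Ω (ζ - 1) with hlam
  obtain ⟨v, hv⟩ := hu.exists_right_inv
  have hlu : lam ^ (p - 1) = p * algebraMap T Ω u := by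
    rw [hlam, ← map_pow, hζu, map_mul, map_natCast]
  have huv : algebraMap T Ω u * algebraMap T Ω v = 1 := by rw [← map_mul, hv, map_one]
  have hl0 : lam ≠ 0 := by
    intro h
    rw [h, zero_pow hp1.ne'] at hlu
    exact mul_ne_zero hp0 (left_ne_zero_of_mul_eq_one huv) hlu.symm
  set x := ω - algebraMap S Ω h with hx
  have hint := isIntegral_of_mul_eq_sub_pow hp hp0 hω (a := a) (by rw [← ha]; ring)
    (y := x ^ (p - 1) / p) (mul_div_cancel₀ _ hp0)
  have hvint : IsIntegral S (algebraMap T Ω v) :=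
    (IsIntegralClosure.isIntegral_iff (A := T)).2 ⟨v, rfl⟩
  have hw : IsIntegral S (x / lam) := by
    refine IsIntegral.of_pow hp1 ?_
    have : (x / lam) ^ (p - 1) = x ^ (p - 1) / p * algebraMap T Ω v := by
      rw [div_pow, hlu, div_mul_eq_mul_div, div_eq_div_iff
        (mul_ne_zero hp0 (left_ne_zero_of_mul_eq_one huv)) hp0]
      linear_combination (-(x ^ (p - 1) * p)) * huv
    rw [this]
    exact hint.mul hvint
  obtain ⟨w, hw⟩ := IsIntegralClosure.exists_algebraMap_eq (T := T) hw
  exact ⟨w, by rw [map_mul, hw, ← hlam, mul_div_cancel₀ _ hl0]⟩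

theorem isIntegral_scaledMonomial {S T Ω ι₁ ι₂ : Type*} [CommRing S] [CommRing T] [Field Ω]
    [Algebra S Ω] [Algebra T Ω] [IsIntegralClosure T S Ω] [Fintype ι₁] [Fintype ι₂] {p : ℕ}
    {f : ι₁ → S} {g : ι₂ → S} (hp : p.Prime) (hp0 : (p : Ω) ≠ 0) {ζ u : T}
    (hu : IsUnit u) (hζu : (ζ - 1) ^ (p - 1) = p * u) {h : ι₁ → S}
    (hf : ∀ i, f i - h i ^ p ∈ Ideal.span {(p : S) ^ 2}) {ω : ι₁ → Ω} {κ : ι₂ → Ω}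
    (hω : ∀ i, ω i ^ p = algebraMap S Ω (f i))
    (hκ : ∀ j, κ j ^ p = algebraMap S Ω (g j)) (m : ι₁ ⊕ ι₂ → Fin p) :
    IsIntegral S (scaledMonomial p (fun i => ω i - algebraMap S Ω (h i)) κ m) := by
  choose w hw using fun i => exists_sub_one_mul_eq_sub hp hp0 hu hζu (hf i) (hω i)
  choose y hy using fun j => IsIntegralClosure.exists_algebraMap_eq (T := T)
    (IsIntegral.of_pow hp.pos (hκ j ▸ isIntegral_algebraMap))
  simp_rw [← hw, show κ = fun j => algebraMap T Ω (y j) from funext fun j => (hy j).symm]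
  rw [scaledMonomial_eq_algebraMap hp0 hζu]
  exact (IsIntegralClosure.isIntegral_iff (A := T)).2 ⟨_, rfl⟩

/-! ### Saturation of the span at `p` -/

section Descent

variable {S : Type*} [CommRing S] [IsDomain S] [IsNoetherianRing S]
  {p : ℕ} {F : Type*} [Field F] [Algebra (S ⧸ Ideal.span {(p : S)}) F]
  {ι₁ ι₂ : Type*} {f : ι₁ → S} {g : ι₂ → S}
  {Ω : Type*} [Field Ω] [Algebra S Ω] {T : Type*} [CommRing T] [Algebra S T] [Algebra T Ω]
  [IsScalarTower S T Ω] [IsIntegralClosure T S Ω]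

variable [Fintype ι₁] [Fintype ι₂] [DecidableEq ι₁] [DecidableEq ι₂] [IsFractionRing (S ⧸ Ideal.span {(p : S)}) F]

theorem mem_span_scaledMonomial_of_smul_mem [IsDomain T] (hp : p.Prime) (hpS : Prime (p : S))
    (hp0 : (p : Ω) ≠ 0)
    (hf : IsClassOneTower p f) (hdisj : LinearlyDisjointModP p F g) {h : ι₁ → S}
    (hh : ∀ i, f i - h i ^ p ∈ Ideal.span {(p : S) ^ 2}) {ω : ι₁ → Ω} {κ : ι₂ → Ω}
    (hω : ∀ i, ω i ^ p = algebraMap S Ω (f i)) (hκ : ∀ j, κ j ^ p = algebraMap S Ω (g j))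
    {P : Ideal T} [hP : P.IsPrime] (hPS : P.comap (algebraMap S T) = Ideal.span {(p : S)})
    {ζ u : T} (hζ : IsPrimitiveRoot ζ p) (hu : IsUnit u) (hζu : (ζ - 1) ^ (p - 1) = p * u)
    (hσ : ∀ j : ι₁ ⊕ ι₂ → ℕ, ∃ σ : Ω →ₐ[S] Ω,
      ∀ i, σ (Sum.elim ω κ i) = algebraMap T Ω ζ ^ j i * Sum.elim ω κ i)
    {z : Ω} (hz : IsIntegral S z)
    (hpz : (p : S) • z ∈ Submodule.span S
      (Set.range (scaledMonomial p (fun i => ω i - algebraMap S Ω (h i)) κ))) :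
    z ∈ Submodule.span S
      (Set.range (scaledMonomial p (fun i => ω i - algebraMap S Ω (h i)) κ)) := by
  have hinj : Function.Injective (algebraMap T Ω) := IsIntegralClosure.algebraMap_injective T S Ω
  obtain ⟨γ, hγ⟩ := (Submodule.mem_span_range_iff_exists_fun S).1 hpz
  choose w hw using fun i => exists_sub_one_mul_eq_sub hp hp0 hu hζu (hh i) (hω i)
  choose y hy using fun j => IsIntegralClosure.exists_algebraMap_eq (T := T)
    (IsIntegral.of_pow hp.pos (hκ j ▸ isIntegral_algebraMap))
  choose η hη using fun i => IsIntegralClosure.exists_algebraMap_eq (T := T)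
    (IsIntegral.of_pow hp.pos (hω i ▸ isIntegral_algebraMap))
  have hyκ : κ = fun j => algebraMap T Ω (y j) := funext fun j => (hy j).symm
  have hyp : ∀ j, y j ^ p = algebraMap S T (g j) := fun j => hinj (by
    rw [map_pow, hy, hκ, ← IsScalarTower.algebraMap_apply])
  have hηp : ∀ i, η i ^ p = algebraMap S T (f i) := fun i => hinj (by
    rw [map_pow, hη, hω, ← IsScalarTower.algebraMap_apply])
  have hpP : (p : T) ∈ P := by
    have : (p : S) ∈ P.comap (algebraMap S T) := hPS ▸ Ideal.mem_span_singleton_self _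
    simpa using this
  have hζP : ζ - 1 ∈ P := hP.mem_of_pow_mem (p - 1) (hζu ▸ P.mul_mem_right _ hpP)
  have hηP : ∀ i, η i ∉ P := by
    intro i hi
    have h1 : f i ∈ P.comap (algebraMap S T) := by
      rw [Ideal.mem_comap, ← hηp]
      exact P.pow_mem_of_mem hi _ hp.pos
    rw [hPS, Ideal.mem_span_singleton] at h1
    exact (hf.squareFree i).not_dvd_of_mem_pthPowersModSq hp hpS (hf.mem_pthPowersModSq i) h1
  have hdvd := dvd_of_forall_grid_sum_dvd hp (hζ.ne_one hp.one_lt) hu hζu hζP hηP (w := w)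
    (fun c hc => hdisj.dvd_of_sum_mem hp hpS hPS hyp c hc)
    (γ := fun a b => γ (Sum.elim a b)) (by
      intro j
      -- Only the `ω i` are moved; the `κ j` stay fixed, so their sums remain intact for linear
      -- disjointness.
      obtain ⟨σ, hσ⟩ := hσ (Sum.elim (fun i => j i) fun _ => 0)
      obtain ⟨t, ht⟩ := IsIntegralClosure.exists_algebraMap_eq (T := T) (hz.map σ)
      refine ⟨t, hinj ?_⟩
      have h1 := congrArg σ hγ
      rw [map_sum, map_smul, ← ht, Algebra.smul_def, map_natCast, ← map_natCast (algebraMap T Ω),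
        ← map_mul] at h1
      rw [← h1, map_sum, ← (Equiv.sumArrowEquivProdArrow ι₁ ι₂ (Fin p)).symm.sum_comp,
        Fintype.sum_prod_type]
      refine Finset.sum_congr rfl fun a _ => ?_
      rw [mul_assoc, Finset.sum_mul, map_sum]
      refine Finset.sum_congr rfl fun b _ => ?_
      have hab : (Equiv.sumArrowEquivProdArrow ι₁ ι₂ (Fin p)).symm (a, b) = Sum.elim a b := rfl
      have hx : (σ ∘ fun i => ω i - algebraMap S Ω (h i)) = fun i => algebraMap T Ω
          ((ζ - 1) * (w i + η i * ∑ l ∈ Finset.range (j i), ζ ^ l)) := by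
        funext i
        have h2 := hσ (Sum.inl i)
        simp only [Sum.elim_inl] at h2
        have h3 : (ζ - 1) * (w i + η i * ∑ l ∈ Finset.range (j i), ζ ^ l) =
            (ζ - 1) * w i + η i * (ζ ^ (j i : ℕ) - 1) := by
          rw [← geom_sum_mul]; ring
        rw [Function.comp_apply, map_sub, h2, AlgHom.commutes, h3, map_add, hw, map_mul, hη,
          map_sub, map_pow, map_one]
        ring
      have hy' : (σ ∘ κ) = fun j => algebraMap T Ω (y j) := by
        funext k
        have h2 := hσ (Sum.inr k)
        simp only [Sum.elim_inr, pow_zero, one_mul] at h2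
        rw [Function.comp_apply, h2, hy]
      rw [map_smul, ← AlgHom.coe_toRingHom, map_scaledMonomial, AlgHom.coe_toRingHom, hx, hy',
        scaledMonomial_eq_algebraMap hp0 hζu, hab, Algebra.smul_def,
        IsScalarTower.algebraMap_apply S T Ω, ← map_mul]
      simp only [Sum.elim_inl, Sum.elim_inr]
      congr 1
      ring)
  choose δ hδ using hdvd
  refine (Submodule.mem_span_range_iff_exists_fun S).2
    ⟨fun m => δ (fun i => m (Sum.inl i)) (fun j => m (Sum.inr j)), ?_⟩
  have hpS0 : algebraMap S Ω (p : S) ≠ 0 := by rwa [map_natCast]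
  have h1 : (p : S) • (∑ m, δ (fun i => m (Sum.inl i)) (fun j => m (Sum.inr j)) •
      scaledMonomial p (fun i => ω i - algebraMap S Ω (h i)) κ m) = (p : S) • z := by
    rw [← hγ, Finset.smul_sum]
    refine Finset.sum_congr rfl fun m _ => ?_
    rw [smul_smul, ← hδ]
    congr 2
    ext (i | j) <;> rfl
  rw [Algebra.smul_def, Algebra.smul_def] at h1
  exact mul_left_cancel₀ hpS0 h1

end Descent

theorem sub_algebraMap_pow_mem_span {R A : Type*} [CommRing R] [CommRing A] [Algebra R A] {p : ℕ}
    (hp : 0 < p) {ω : A} {f : R} (hω : ω ^ p = algebraMap R A f) (h : R) :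
    (ω - algebraMap R A h) ^ p ∈
      Submodule.span R (Set.range fun k : Fin p => (ω - algebraMap R A h) ^ (k : ℕ)) := by
  set x := ω - algebraMap R A h with hx
  have hmem : ∀ k < p, x ^ k ∈ Submodule.span R (Set.range fun k : Fin p => x ^ (k : ℕ)) :=
    fun k hk => Submodule.subset_span ⟨⟨k, hk⟩, rfl⟩
  have h1 : x ^ p = f • x ^ 0 -
      ∑ k ∈ Finset.range p, (h ^ (p - k) * (p.choose k : R)) • x ^ k := by
    rw [pow_zero, ← Algebra.algebraMap_eq_smul_one, ← hω,
      show ω = x + algebraMap R A h by rw [hx]; ring, add_pow, Finset.sum_range_succ]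
    simp only [Nat.sub_self, pow_zero, mul_one, Nat.choose_self, Nat.cast_one]
    rw [add_sub_assoc, eq_comm, add_sub_left_comm]
    refine add_eq_left.2 (sub_eq_zero.2 (Finset.sum_congr rfl fun k _ => ?_))
    rw [Algebra.smul_def, map_mul, map_pow, map_natCast]
    ring
  rw [h1]
  exact Submodule.sub_mem _ (Submodule.smul_mem _ _ (hmem 0 hp))
    (Submodule.sum_mem _ fun k hk => Submodule.smul_mem _ _ (hmem k (Finset.mem_range.1 hk)))

/-- Translating `ω i` by `h i` does not change the algebra generated, and each translated monomial
is a power of `p` times its scaled version. -/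
theorem span_box_le_span_scaledMonomial {R A ι₁ ι₂ : Type*} [CommRing R] [Field A] [Algebra R A]
    [Fintype ι₁] [Fintype ι₂] {p : ℕ} (hp : 0 < p) (hp0 : (p : A) ≠ 0) {ω : ι₁ → A} {κ : ι₂ → A}
    {f : ι₁ → R} {g : ι₂ → R} (hω : ∀ i, ω i ^ p = algebraMap R A (f i))
    (hκ : ∀ j, κ j ^ p = algebraMap R A (g j)) (h : ι₁ → R) :
    Submodule.span R (Set.range fun m : ι₁ ⊕ ι₂ → Fin p => ∏ i, Sum.elim ω κ i ^ (m i : ℕ)) ≤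
      Submodule.span R
        (Set.range (scaledMonomial p (fun i => ω i - algebraMap R A (h i)) κ)) := by
  set y : ι₁ ⊕ ι₂ → A := Sum.elim (fun i => ω i - algebraMap R A (h i)) κ with hy
  have hadj : ∀ i, Sum.elim ω κ i ∈ Algebra.adjoin R (Set.range y) := by
    rintro (i | j)
    · have h1 : y (Sum.inl i) ∈ Algebra.adjoin R (Set.range y) := Algebra.subset_adjoin ⟨_, rfl⟩
      have h2 := add_mem h1 (algebraMap_mem (Algebra.adjoin R (Set.range y)) (h i))
      simpa [hy] using h2
    · exact Algebra.subset_adjoin ⟨Sum.inr j, rfl⟩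
  have hpow : ∀ i, y i ^ p ∈ Submodule.span R (Set.range fun k : Fin p => y i ^ (k : ℕ)) := by
    rintro (i | j)
    · exact sub_algebraMap_pow_mem_span hp (hω i) (h i)
    · simpa [hy] using sub_algebraMap_pow_mem_span hp (hκ j) 0
  rw [Submodule.span_le]
  rintro _ ⟨m, rfl⟩
  have h1 : ∏ i, Sum.elim ω κ i ^ (m i : ℕ) ∈
      Subalgebra.toSubmodule (Algebra.adjoin R (Set.range y)) :=
    (Subalgebra.mem_toSubmodule _).2 (prod_mem fun i _ => pow_mem (hadj i) _)
  refine Submodule.span_le.2 ?_ (Algebra.adjoin_range_le_span_box hp hpow h1)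
  rintro _ ⟨k, rfl⟩
  have h2 : ∏ i, y i ^ (k i : ℕ) = ((p : R) ^ ((∑ i, (k (Sum.inl i) : ℕ)) / (p - 1))) •
      scaledMonomial p (fun i => ω i - algebraMap R A (h i)) κ k := by
    rw [scaledMonomial, Algebra.smul_def, map_pow, map_natCast, mul_div_cancel₀ _ (pow_ne_zero _ hp0),
      Fintype.prod_sum_type]
    rfl
  change ∏ i, y i ^ (k i : ℕ) ∈ _
  rw [h2]
  exact Submodule.smul_mem _ _ (Submodule.subset_span ⟨k, rfl⟩)

/-! ### Spanning, independence and the theorem -/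

section Main

variable {S : Type*} [CommRing S] [IsDomain S] [IsNoetherianRing S] [IsIntegrallyClosed S]
  {p : ℕ} {L : Type*} [Field L] [Algebra S L] [IsFractionRing S L]
  {F : Type*} [Field F] [Algebra (S ⧸ Ideal.span {(p : S)}) F]
  [IsFractionRing (S ⧸ Ideal.span {(p : S)}) F] {ι₁ ι₂ : Type*} [Fintype ι₁] [Fintype ι₂]
  [DecidableEq ι₁] [DecidableEq ι₂] {f : ι₁ → S} {g : ι₂ → S}

/-- An integral element of the span of the monomials in the `p`-th roots is an integral combination
of the scaled monomials. -/
theorem mem_span_scaledMonomial_of_isIntegral {Ω : Type*} [Field Ω] [Algebra L Ω] [Algebra S Ω]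
    [IsScalarTower S L Ω] [CharZero L] [IsAlgClosed Ω] [Algebra.IsAlgebraic L Ω]
    {T : Type*} [CommRing T] [IsDomain T] [Algebra S T] [Algebra T Ω] [IsScalarTower S T Ω]
    [IsIntegralClosure T S Ω] (hp : p.Prime)
    (hpS : Prime (p : S)) (hf : IsClassOneTower p f) (hg : ∀ j, IsSquareFreeElem (g j))
    (hA : SatisfiesA1 (Sum.elim f g)) (hdisj : LinearlyDisjointModP p F g) {h : ι₁ → S}
    (hh : ∀ i, f i - h i ^ p ∈ Ideal.span {(p : S) ^ 2}) {ω : ι₁ → Ω} {κ : ι₂ → Ω}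
    (hω : ∀ i, ω i ^ p = algebraMap S Ω (f i)) (hκ : ∀ j, κ j ^ p = algebraMap S Ω (g j))
    {P : Ideal T} [hP : P.IsPrime] (hPS : P.comap (algebraMap S T) = Ideal.span {(p : S)})
    {ζ u : T} (hζ : IsPrimitiveRoot ζ p) (hu : IsUnit u) (hζu : (ζ - 1) ^ (p - 1) = p * u)
    {z : Ω} (hz : IsIntegral S z)
    (hzspan : z ∈ Submodule.span L
      (Set.range fun m : ι₁ ⊕ ι₂ → Fin p => ∏ i, Sum.elim ω κ i ^ (m i : ℕ))) :
    z ∈ Submodule.span S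
      (Set.range (scaledMonomial p (fun i => ω i - algebraMap S Ω (h i)) κ)) := by
  have : CharZero Ω := charZero_of_injective_algebraMap (algebraMap L Ω).injective
  have hp0 : (p : Ω) ≠ 0 := Nat.cast_ne_zero.2 hp.ne_zero
  have hζΩ : IsPrimitiveRoot (algebraMap T Ω ζ) p :=
    hζ.map_of_injective (IsIntegralClosure.algebraMap_injective T S Ω)
  have hσ := fun j => exists_algHom_apply_eq_pow_mul (L := L) hp hpS hf hA hdisj hω hκ hζΩ j
  set M := Submodule.span S
    (Set.range (scaledMonomial p (fun i => ω i - algebraMap S Ω (h i)) κ)) with hM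
  have hW : ∀ i, Sum.elim ω κ i ^ p = algebraMap S Ω (Sum.elim f g i) := by
    rintro (i | i)
    · exact hω i
    · exact hκ i
  have hsq : ∀ i, IsSquareFreeElem (Sum.elim f g i) := by
    rintro (i | i)
    · exact hf.squareFree i
    · exact hg i
  obtain ⟨c, hc⟩ := (Submodule.mem_span_range_iff_exists_fun L).1 hzspan
  have hcoef := isIntegral_coeff_of_sum hp hsq hA hW hζΩ
    (fun j => (hσ j).imp fun σ hσ => hσ.2) (c := c) (hc ▸ hz)
  choose s hs using hcoef
  have hpow : ((p : S) ^ Fintype.card (ι₁ ⊕ ι₂)) • z ∈ M := by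
    refine span_box_le_span_scaledMonomial hp.pos hp0 hω hκ h ?_
    refine (Submodule.mem_span_range_iff_exists_fun S).2 ⟨s, ?_⟩
    rw [← hc, Finset.smul_sum]
    refine Finset.sum_congr rfl fun m _ => ?_
    rw [Algebra.smul_def, IsScalarTower.algebraMap_apply S L Ω, hs, Algebra.smul_def,
      Algebra.smul_def, map_mul, map_pow, map_pow, map_natCast, map_natCast, mul_assoc]
  -- Saturation strips one factor of `p` at a time, applied to the integral element `p ^ N • z`.
  have hdesc : ∀ N, ((p : S) ^ N) • z ∈ M → z ∈ M := by
    intro N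
    induction N with
    | zero => intro h0; simpa using h0
    | succ N ih =>
      intro h1
      refine ih (mem_span_scaledMonomial_of_smul_mem hp hpS hp0 hf hdisj hh hω hκ hPS hζ hu hζu
        (fun j => ?_) (hz.smul _) ?_)
      · obtain ⟨σ, -, hσ⟩ := hσ j
        exact ⟨σ.restrictScalars S, hσ⟩
      · rwa [smul_smul, ← pow_succ']
  exact hdesc _ hpow

theorem free_and_finite_integralClosure_of_tower {K : Type*} [Field K] [Algebra L K] [Algebra S K]
    [IsScalarTower S L K] (hp : p.Prime)
    (hpS : Prime (p : S)) (hf : IsClassOneTower p f) (hg : ∀ j, IsSquareFreeElem (g j))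
    (hA : SatisfiesA1 (Sum.elim f g)) (hdisj : LinearlyDisjointModP p F g)
    {ω : ι₁ → K} {κ : ι₂ → K}
    (hω : ∀ i, ω i ^ p = algebraMap S K (f i)) (hκ : ∀ j, κ j ^ p = algebraMap S K (g j))
    (hspan : Submodule.span L
      (Set.range fun m : ι₁ ⊕ ι₂ → Fin p => ∏ i, Sum.elim ω κ i ^ (m i : ℕ)) = ⊤) :
    Module.Free S (integralClosure S K) ∧ Module.Finite S (integralClosure S K) := by
  have := charZero_of_prime_natCast hp hpS
  have : CharZero L := charZero_of_injective_algebraMap (IsFractionRing.injective S L)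
  have : CharZero K := charZero_of_injective_algebraMap (algebraMap L K).injective
  have hp0 : (p : K) ≠ 0 := Nat.cast_ne_zero.2 hp.ne_zero
  have hKfin : Module.Finite L K := ⟨by
    rw [← hspan]; exact Submodule.fg_span (Set.finite_range _)⟩
  let Ω := AlgebraicClosure K
  have : Algebra.IsAlgebraic L Ω := Algebra.IsAlgebraic.trans L K Ω
  have hinj : Function.Injective (algebraMap S Ω) := by
    rw [IsScalarTower.algebraMap_eq S L Ω]
    exact (algebraMap L Ω).injective.comp (IsFractionRing.injective S L)
  have : FaithfulSMul S Ω := (faithfulSMul_iff_algebraMap_injective S Ω).2 hinj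
  have hI : (Ideal.span {(p : S)}).IsPrime := (Ideal.span_singleton_prime hpS.ne_zero).2 hpS
  obtain ⟨P, hP, hPS⟩ := exists_prime_integralClosure_over (Ω := Ω) (Ideal.span {(p : S)})
  have : NeZero (p : Ω) := ⟨by
    rw [← map_natCast (algebraMap K Ω)]
    exact (map_ne_zero (algebraMap K Ω)).2 hp0⟩
  obtain ⟨ζ, hζ⟩ := HasEnoughRootsOfUnity.exists_primitiveRoot Ω p
  let ζT : integralClosure S Ω := ⟨ζ, (hζ.isIntegral hp.pos).tower_top⟩
  have hζT : IsPrimitiveRoot ζT p :=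
    IsPrimitiveRoot.of_map_of_injective (f := algebraMap (integralClosure S Ω) Ω) hζ
      Subtype.val_injective
  obtain ⟨u, hu, hζu⟩ := hζT.exists_isUnit_sub_one_pow_eq hp
  choose h hh using hf.mem_pthPowersModSq
  let ωΩ : ι₁ → Ω := fun i => algebraMap K Ω (ω i)
  let κΩ : ι₂ → Ω := fun j => algebraMap K Ω (κ j)
  have hωΩ : ∀ i, ωΩ i ^ p = algebraMap S Ω (f i) := fun i => by
    rw [← map_pow, hω, ← IsScalarTower.algebraMap_apply]
  have hκΩ : ∀ i, κΩ i ^ p = algebraMap S Ω (g i) := fun i => by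
    rw [← map_pow, hκ, ← IsScalarTower.algebraMap_apply]
  let e : (ι₁ ⊕ ι₂ → Fin p) → K := scaledMonomial p (fun i => ω i - algebraMap S K (h i)) κ
  have hmape : ∀ m, algebraMap K Ω (e m) =
      scaledMonomial p (fun i => ωΩ i - algebraMap S Ω (h i)) κΩ m := by
    intro m
    rw [map_scaledMonomial]
    congr 1
    funext i
    rw [Function.comp_apply, map_sub, ← IsScalarTower.algebraMap_apply S K Ω]
  have hmapW : ∀ m : ι₁ ⊕ ι₂ → Fin p, algebraMap K Ω (∏ i, Sum.elim ω κ i ^ (m i : ℕ)) =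
      ∏ i, Sum.elim ωΩ κΩ i ^ (m i : ℕ) := by
    intro m
    rw [map_prod]
    refine Finset.prod_congr rfl fun i _ => ?_
    rcases i with i | i <;> simp [ωΩ, κΩ]
  have heint : ∀ m, IsIntegral S (e m) := by
    intro m
    rw [← isIntegral_algebraMap_iff (algebraMap K Ω).injective, hmape]
    exact isIntegral_scaledMonomial (T := integralClosure S Ω) hp (NeZero.ne _) hu hζu hh hωΩ hκΩ m
  have hmem : ∀ z : K, IsIntegral S z → z ∈ Submodule.span S (Set.range e) := by
    intro z hz
    have h1 : algebraMap K Ω z ∈ Submodule.span L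
        (Set.range fun m : ι₁ ⊕ ι₂ → Fin p => ∏ i, Sum.elim ωΩ κΩ i ^ (m i : ℕ)) := by
      obtain ⟨c, hc⟩ := (Submodule.mem_span_range_iff_exists_fun L).1
        (hspan ▸ Submodule.mem_top : z ∈ _)
      refine (Submodule.mem_span_range_iff_exists_fun L).2 ⟨c, ?_⟩
      have h2 := congrArg (algebraMap K Ω) hc
      rw [map_sum] at h2
      refine Eq.trans (Finset.sum_congr rfl fun m _ => ?_) h2
      rw [← hmapW, Algebra.smul_def, Algebra.smul_def, map_mul,
        ← IsScalarTower.algebraMap_apply L K Ω]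
    have h2 := mem_span_scaledMonomial_of_isIntegral hp hpS hf hg hA hdisj hh hωΩ hκΩ hPS hζT hu
      hζu (hz.algebraMap (B := Ω)) h1
    obtain ⟨c, hc⟩ := (Submodule.mem_span_range_iff_exists_fun S).1 h2
    refine (Submodule.mem_span_range_iff_exists_fun S).2 ⟨c, (algebraMap K Ω).injective ?_⟩
    rw [← hc, map_sum]
    refine Finset.sum_congr rfl fun m _ => ?_
    rw [Algebra.smul_def, map_mul, hmape, Algebra.smul_def, ← IsScalarTower.algebraMap_apply S K Ω]
  have hW : ∀ i, Sum.elim ωΩ κΩ i ^ p = algebraMap S Ω (Sum.elim f g i) := by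
    rintro (i | i)
    · exact hωΩ i
    · exact hκΩ i
  have hW0 : ∀ i, Sum.elim ωΩ κΩ i ≠ 0 := fun i h0 => by
    have h1 := hW i
    rw [h0, zero_pow hp.ne_zero] at h1
    exact elim_ne_zero_of_linearlyDisjointModP hp hpS hf hdisj i
      (hinj (h1.symm.trans (map_zero _).symm))
  have hliΩ : LinearIndependent L
      fun m : ι₁ ⊕ ι₂ → Fin p => ∏ i, Sum.elim ωΩ κΩ i ^ (m i : ℕ) :=
    linearIndependent_monomials hp hW0 hζ fun j =>
      (exists_algHom_apply_eq_pow_mul (L := L) hp hpS hf hA hdisj hωΩ hκΩ hζ j).imp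
        fun σ hσ => hσ.2
  have hliK : LinearIndependent L
      fun m : ι₁ ⊕ ι₂ → Fin p => ∏ i, Sum.elim ω κ i ^ (m i : ℕ) := by
    refine LinearIndependent.of_comp (IsScalarTower.toAlgHom L K Ω).toLinearMap ?_
    convert hliΩ using 1
    funext m
    exact hmapW m
  have hcard : Fintype.card (ι₁ ⊕ ι₂ → Fin p) = Module.finrank L K := by
    rw [← finrank_top L K, ← hspan, finrank_span_eq_card hliK]
  -- Over `L` the scaled monomials span as well, and there are `[K : L]` of them, so they are
  -- independent over `L` and hence over `S`.
  have hetop : ⊤ ≤ Submodule.span L (Set.range e) := by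
    have h1 := span_box_le_span_scaledMonomial (R := L) hp.pos hp0 (ω := ω) (κ := κ)
      (f := fun i => algebraMap S L (f i)) (g := fun i => algebraMap S L (g i))
      (fun i => by rw [hω, ← IsScalarTower.algebraMap_apply])
      (fun i => by rw [hκ, ← IsScalarTower.algebraMap_apply]) (fun i => algebraMap S L (h i))
    simp_rw [← IsScalarTower.algebraMap_apply S L K] at h1
    rwa [hspan] at h1
  have heli : LinearIndependent S e := by
    have h1 := linearIndependent_of_top_le_span_of_card_eq_finrank hetop hcard
    exact h1.restrict_scalars (by
      intro a b hab
      refine IsFractionRing.injective S L ?_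
      simpa [Algebra.smul_def] using hab)
  let b : (ι₁ ⊕ ι₂ → Fin p) → integralClosure S K := fun m => ⟨e m, heint m⟩
  have hbli : LinearIndependent S b :=
    LinearIndependent.of_comp (integralClosure S K).val.toLinearMap heli
  have hbspan : ⊤ ≤ Submodule.span S (Set.range b) := by
    rintro ⟨z, hz⟩ -
    obtain ⟨c, hc⟩ := (Submodule.mem_span_range_iff_exists_fun S).1 (hmem z hz)
    refine (Submodule.mem_span_range_iff_exists_fun S).2 ⟨c, Subtype.ext (Eq.trans ?_ hc)⟩
    simp [b]
  let B := Module.Basis.mk hbli hbspan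
  exact ⟨Module.Free.of_basis B, Module.Finite.of_basis B⟩

end Main

theorem proposition5p2
    {S : Type*} [CommRing S] [IsDomain S] [IsNoetherianRing S] [IsIntegrallyClosed S]
    (p : ℕ) (hp : p.Prime) (hpS : Prime (p : S))
    (L : Type*) [Field L] [Algebra S L] [IsFractionRing S L]
    (F : Type*) [Field F] [Algebra (S ⧸ Ideal.span {(p : S)}) F]
    [IsFractionRing (S ⧸ Ideal.span {(p : S)}) F]
    {r t : ℕ} (f : Fin r → S) (g : Fin t → S)
    (hf : IsClassOneTower p f)
    (hg : ∀ j, IsSquareFreeElem (g j))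
    (hA1 : SatisfiesA1 (Sum.elim f g))
    (hdisj : LinearlyDisjointModP p F g)
    (E : Type*) [Field E] [Algebra L E] [Algebra S E] [IsScalarTower S L E]
    (ω : Fin r → E) (hω : ∀ i, ω i ^ p = algebraMap S E (f i))
    (κ : Fin t → E) (hκ : ∀ j, κ j ^ p = algebraMap S E (g j))
    (K : IntermediateField L E)
    (hK : K = IntermediateField.adjoin L (Set.range ω ∪ Set.range κ)) :
    Module.Free S (integralClosure S K) ∧
      (IsCohenMacaulayRing S ∨ IsUnramifiedRegularLocalRing p S →
        IsCohenMacaulayRing (integralClosure S K)) := by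
  have hωK : ∀ i, ω i ∈ K := fun i => by
    rw [hK]; exact IntermediateField.subset_adjoin L _ (Or.inl ⟨i, rfl⟩)
  have hκK : ∀ j, κ j ∈ K := fun j => by
    rw [hK]; exact IntermediateField.subset_adjoin L _ (Or.inr ⟨j, rfl⟩)
  have hmain : Module.Free S (integralClosure S K) ∧ Module.Finite S (integralClosure S K) := by
    refine free_and_finite_integralClosure_of_tower (L := L) hp hpS hf hg hA1 hdisj
      (ω := fun i => (⟨ω i, hωK i⟩ : K)) (κ := fun j => (⟨κ j, hκK j⟩ : K))
      (fun i => Subtype.ext (hω i)) (fun j => Subtype.ext (hκ j)) ?_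
    rw [eq_top_iff]
    rintro ⟨z, hz⟩ -
    have hW : ∀ i, Sum.elim ω κ i ^ p = algebraMap L E (algebraMap S L (Sum.elim f g i)) := by
      rintro (i | i)
      · rw [← IsScalarTower.algebraMap_apply]; exact hω i
      · rw [← IsScalarTower.algebraMap_apply]; exact hκ i
    have hz' : z ∈ Algebra.adjoin L (Set.range (Sum.elim ω κ)) := by
      rw [← IntermediateField.adjoin_toSubalgebra_of_isAlgebraic]
      · rw [hK] at hz
        rw [Set.Sum.elim_range]
        exact hz
      · rintro _ ⟨i, rfl⟩
        exact (IsIntegral.of_pow hp.pos (hW i ▸ isIntegral_algebraMap)).isAlgebraic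
    -- Translation by `0` supplies the relation `W i ^ p ∈ L`, so the monomials span `K`, which is
    -- generated as an algebra by algebraic elements.
    have hzs := Algebra.adjoin_range_le_span_box (p := p) hp.pos (fun i => by
      simpa using sub_algebraMap_pow_mem_span hp.pos (hW i) 0) hz'
    obtain ⟨c, hc⟩ := (Submodule.mem_span_range_iff_exists_fun L).1 hzs
    refine (Submodule.mem_span_range_iff_exists_fun L).2 ⟨c, K.val.injective ?_⟩
    change _ = z
    rw [← hc, map_sum]
    refine Finset.sum_congr rfl fun m _ => ?_
    change c m • K.val (∏ i, _) = _
    congr 1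
    rw [map_prod]
    refine Finset.prod_congr rfl fun i _ => ?_
    rcases i with i | i <;> rfl
  obtain ⟨hfree, hfin⟩ := hmain
  refine ⟨hfree, fun h => IsCohenMacaulayRing.of_free (A := S) ?_⟩
  rcases h with h | h
  · exact h
  · have := h.isRegularLocalRing
    exact IsRegularLocalRing.isCohenMacaulayRing S
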